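/- Let $X$ be a compact geodesic metric space (any two points $x,y$ are joined by an isometric embedding of $[0,d(x,y)]$) with basepoint $\bullet\in X$. For $r>0$ let $\mathrm{Rips}(X,r)$ be the open Rips complex, whose simplices are the nonempty finite subsets of $X$ of diameter less than $r$. A number $p>0$ is a critical value (of the open-Rips $\pi_1$-persistence of $X$) if either for all sufficiently small $\varepsilon>0$ the inclusion-induced map $\pi_1(\mathrm{Rips}(X,p-\varepsilon),\bullet)\to\pi_1(\mathrm{Rips}(X,p),\bullet)$ is not an isomorphism, or for all $\varepsilon>0$ the inclusion-induced map $\pi_1(\mathrm{Rips}(X,p),\bullet)\to\pi_1(\mathrm{Rips}(X,p+\varepsilon),\bullet)$ is not an isomorphism. A lasso is a loop $\alpha*\beta*\alpha^-$, where $\alpha$ is a path in $X$ starting at $\bullet$ and $\beta$ is a loop based at the endpoint of $\alpha$. Let $\mathcal L(X,r,\pi_1)\le\pi_1(X,\bullet)$ be the subgroup generated by the lassos for which $\beta$ has length less than $r$, and let $\mathcal S(X,r,\pi_1)\le\pi_1(X,\bullet)$ be the subgroup generated by the lassos for which $\beta$ lies in a closed ball $\overline B(x,d)$ for some $x\in X$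 and some $d<r$. A geodesic circle of length $l>0$ is an isometric embedding into $X$ of the circle of circumference $l$ with its arc-length metric. A geodesic $l$-lasso is a lasso $\alpha*\beta*\alpha^-$ such that $\beta$ traverses a geodesic circle of length $l$ once; here $\alpha$ is an arbitrary path from $\bullet$ to a point of the circle. Then the following hold. (a) For each $r>0$ there are only finitely many critical values greater than $r$. (b) If $q<p$ are consecutive critical values, then $\mathcal L(X,3p,\pi_1)$ is generated by $\mathcal L(X,3q,\pi_1)$ together with (the homotopy classes of) a collection of geodesic $3q$-lassos. (c) For every critical value $q$ there is a geodesic circle of length $3q$ in $X$. (d) If $q<p$ are consecutive critical values and $A$ is any collection of geodesic $3q$-lassos as in (b), that is, one which together with $\mathcal L(X,3q,\pi_1)$ generates $\mathcal L(X,3p,\pi_1)$, then $\mathcal S(X,3p/2,\pi_1)$ is generated by $\mathcal S(X,3q/2,\pi_1)$ together with $A$. -/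

import Mathlib

noncomputable section

namespace RipsPersistence

/-! ### Geometric realization of an abstract simplicial complex -/

section Realization

variable {ι : Type*}

/-- A point of the geometric realization of `K`, given by its barycentric coordinates: a finitely
supported nonnegative weight on the vertices of total mass one whose support is a simplex. -/
@[ext]
structure Realization (K : AbstractSimplicialComplex ι) where
  weight : ι →₀ ℝ
  nonneg : ∀ v, 0 ≤ weight v
  sum_eq_one : (weight.sum fun _ a => a) = 1
  support_mem : weight.support ∈ K.faces

/-- The closed simplex of the realization spanned by the vertices in `σ`. -/
structure ClosedSimplex (K : AbstractSimplicialComplex ι) (σ : Finset ι) where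
  point : Realization K
  support_subset : point.weight.support ⊆ σ

/-- A closed simplex carries the Euclidean topology of barycentric coordinates. -/
instance (K : AbstractSimplicialComplex ι) (σ : Finset ι) :
    TopologicalSpace (ClosedSimplex K σ) :=
  TopologicalSpace.induced (fun w => (w.point.weight : ι → ℝ)) inferInstance

/-- The weak (coherent) topology: a set is open iff its trace on each closed simplex is open. -/
instance (K : AbstractSimplicialComplex ι) : TopologicalSpace (Realization K) :=
  ⨆ σ : K.faces, TopologicalSpace.coinduced
    (fun w : ClosedSimplex K σ.1 => w.point) inferInstance

theorem isOpen_realization_iff {K : AbstractSimplicialComplex ι} {U : Set (Realization K)} :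
    IsOpen U ↔ ∀ σ ∈ K.faces, IsOpen {w : ClosedSimplex K σ | w.point ∈ U} := by
  rw [isOpen_iSup_iff, Subtype.forall]
  rfl

/-- The point of the realization given by a vertex. -/
def Realization.vertex (K : AbstractSimplicialComplex ι) (v : ι) : Realization K where
  weight := Finsupp.single v 1
  nonneg w := by
    classical
    rw [Finsupp.single_apply]
    split_ifs <;> norm_num
  sum_eq_one := by simp
  support_mem := by
    rw [Finsupp.support_single v one_ne_zero]
    exact K.singleton_mem v

/-- The inclusion of the realization of a subcomplex. -/
def Realization.inclusion {K L : AbstractSimplicialComplex ι} (h : K ≤ L) :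
    C(Realization K, Realization L) where
  toFun w := ⟨w.weight, w.nonneg, w.sum_eq_one, h w.support_mem⟩
  continuous_toFun := by
    refine continuous_def.2 fun U hU => isOpen_realization_iff.2 fun σ hσ => ?_
    have hc : Continuous (fun w : ClosedSimplex K σ =>
        (⟨⟨w.point.weight, w.point.nonneg, w.point.sum_eq_one, h w.point.support_mem⟩,
          w.support_subset⟩ : ClosedSimplex L σ)) :=
      continuous_induced_rng.2 continuous_induced_dom
    exact (isOpen_realization_iff.1 hU σ (h hσ)).preimage hc

end Realization

/-! ### The open Rips filtration and its `π₁`-persistence -/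

variable {X : Type*} [MetricSpace X]

/-- The open Rips complex `Rips(X, r)`, `r > 0`: the nonempty finite subsets of `X` of diameter
less than `r`. -/
def rips (X : Type*) [MetricSpace X] (r : ℝ) (hr : 0 < r) : AbstractSimplicialComplex X where
  faces := {σ | σ.Nonempty ∧ Metric.diam (σ : Set X) < r}
  isRelLowerSet_faces := by
    rintro σ ⟨hne, hd⟩
    refine ⟨hne, fun τ hτ hτne => ⟨hτne, lt_of_le_of_lt ?_ hd⟩⟩
    exact Metric.diam_mono (by exact_mod_cast hτ) σ.finite_toSet.isBounded
  singleton_mem v := by simpa using hr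

theorem rips_mono {r s : ℝ} (hr : 0 < r) (h : r ≤ s) :
    rips X r hr ≤ rips X s (hr.trans_le h) :=
  fun _ hσ => ⟨hσ.1, hσ.2.trans_le h⟩

/-- The fundamental group `π₁(Rips(X, r), x₀)` of the geometric realization. -/
abbrev RipsPi1 (x₀ : X) (r : ℝ) (hr : 0 < r) : Type _ :=
  FundamentalGroup (Realization (rips X r hr)) (Realization.vertex _ x₀)

/-- The bonding homomorphism `π₁(Rips(X, r), x₀) → π₁(Rips(X, s), x₀)` for `r ≤ s`. -/
def bonding (x₀ : X) {r s : ℝ} (hr : 0 < r) (h : r ≤ s) :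
    RipsPi1 x₀ r hr →* RipsPi1 x₀ s (hr.trans_le h) :=
  FundamentalGroup.map (Realization.inclusion (rips_mono hr h)) (Realization.vertex _ x₀)

/-- `p > 0` is a left critical value: for all small enough `ε > 0` the bonding map from
`p - ε` to `p` is not an isomorphism. -/
def IsLeftCritical (x₀ : X) (p : ℝ) : Prop :=
  0 < p ∧ ∃ δ > 0, ∀ ε : ℝ, 0 < ε → ε < δ → ∀ h : 0 < p - ε, ∀ hle : p - ε ≤ p,
    ¬ Function.Bijective (bonding x₀ h hle)

/-- `p > 0` is a right critical value: for all `ε > 0` the bonding map from `p` to `p + ε` is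
not an isomorphism. -/
def IsRightCritical (x₀ : X) (p : ℝ) : Prop :=
  ∃ hp : 0 < p, ∀ ε : ℝ, 0 < ε → ∀ hle : p ≤ p + ε,
    ¬ Function.Bijective (bonding x₀ hp hle)

/-- `p` is a critical value of the `π₁`-persistence of `(X, x₀)` via open Rips complexes. -/
def IsCriticalValue (x₀ : X) (p : ℝ) : Prop :=
  IsLeftCritical x₀ p ∨ IsRightCritical x₀ p

/-! ### Geodesics, lassos and the subgroups of `π₁(X, x₀)` they generate -/

/-- Any two points `x, y` are joined by an isometric embedding of `[0, dist x y]`. -/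
def IsGeodesicSpace (X : Type*) [MetricSpace X] : Prop :=
  ∀ x y : X, ∃ f : ℝ → X, f 0 = x ∧ f (dist x y) = y ∧
    ∀ s ∈ Set.Icc 0 (dist x y), ∀ t ∈ Set.Icc 0 (dist x y), dist (f s) (f t) = |s - t|

/-- The length of a path (possibly infinite). -/
def pathLength {x y : X} (γ : Path x y) : ENNReal :=
  eVariationOn γ Set.univ

/-- The class in `π₁(X, x₀)` of the lasso `α * β * α⁻`. -/
def lassoClass {x₀ y : X} (α : Path x₀ y) (β : Path y y) : FundamentalGroup X x₀ :=
  FundamentalGroup.fromPath (Path.Homotopic.Quotient.mk ((α.trans β).trans α.symm))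

/-- `L(X, r, π₁)`: the subgroup generated by the `l`-lassos with `l < r`. -/
def lengthSubgroup (x₀ : X) (r : ℝ) : Subgroup (FundamentalGroup X x₀) :=
  Subgroup.closure {g | ∃ (y : X) (α : Path x₀ y) (β : Path y y),
    pathLength β < ENNReal.ofReal r ∧ g = lassoClass α β}

/-- `S(X, r, π₁)`: the subgroup generated by the lassos `α * β * α⁻` for which `β` lies in some
closed ball of radius `d < r`. -/
def spanierSubgroup (x₀ : X) (r : ℝ) : Subgroup (FundamentalGroup X x₀) :=
  Subgroup.closure {g | ∃ (y : X) (α : Path x₀ y) (β : Path y y) (w : X) (d : ℝ),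
    d < r ∧ Set.range β ⊆ Metric.closedBall w d ∧ g = lassoClass α β}

/-- A geodesic circle of length `l`: an isometric embedding of the circle of circumference `l > 0`
with its arc-length metric. -/
def IsGeodesicCircle (l : ℝ) (f : AddCircle l → X) : Prop :=
  0 < l ∧ Isometry f

/-- The loop `β` traverses a geodesic circle of length `l` once at constant speed. -/
def IsGeodesicCircleLoop (l : ℝ) {y : X} (β : Path y y) : Prop :=
  ∃ f : AddCircle l → X, IsGeodesicCircle l f ∧
    ∀ t : unitInterval, β t = f ((l * (t : ℝ) : ℝ) : AddCircle l)

/-- The classes in `π₁(X, x₀)` of the geodesic `l`-lassos `α * β * α⁻`: `β` is a geodesic circle of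
length `l` and `α` is a path from `x₀` to a point of it. -/
def geodesicLassoClasses (x₀ : X) (l : ℝ) : Set (FundamentalGroup X x₀) :=
  {g | ∃ (y : X) (α : Path x₀ y) (β : Path y y), IsGeodesicCircleLoop l β ∧ g = lassoClass α β}

/-- `q < p` are consecutive critical values. -/
def AreConsecutiveCritical (x₀ : X) (q p : ℝ) : Prop :=
  q < p ∧ IsCriticalValue x₀ q ∧ IsCriticalValue x₀ p ∧
    ∀ c, q < c → c < p → ¬ IsCriticalValue x₀ c

end RipsPersistence

end

noncomputable section

namespace RipsPersistence

open scoped Topology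

/-! ### Topology of the geometric realization -/

section Realization

variable {ι Z : Type*} [TopologicalSpace Z] {K : AbstractSimplicialComplex ι}

/-! Write `S(r)` and `L(r)` for `spanierSubgroup x₀ r` and `lengthSubgroup x₀ r`. The whole
filtration is a family of quotients of `π₁(X, x₀)`. A partition of unity gives a map from `X` to
`Rips(X, r)` that moves points very little. On `π₁` it is onto with kernel `S(3r/2)`
(`FineMap.hatHom_surjective`, `FineMap.ker_hatHom`). Loops in a ball of radius less than `3r/2` die
because they can be coned off in two layers of edges. Conversely, if a normal subgroup `N` contains
`L(3r)`, the holonomy of geodesics modulo `N` is a cocycle on the Rips complex, since a triangle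
with sides below `r` has perimeter below `3r`. The covering it defines has a monodromy that recovers
holonomy (`FineMap.exists_monodromy`). So a bonding map is an isomorphism exactly if two groups `S`
agree.

Next, `S(l/2)` is generated by `L(l)` and `S(ε)` for any positive `ε ≤ l/2`
(`spanierSubgroup_eq_sup`), so beyond `S(ε)` only loops of bounded length matter. These form a
compact space by Arzelà–Ascoli, and uniformly close loops agree modulo `S(ε)`. Hence finitely many
elements tell the groups `S(s)` apart on a compact range of scales (`exists_finite_separating`).
This gives (a), and also that jumps happen only to the right of a value. At a jump, loops of length
slightly above `3q` that are nontrivial modulo `S(3q/2)` converge to a nontrivial `3q`-Lipschitz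
loop. A chord shorter than both of its arcs would cut the limit into two shorter loops, so it is a
geodesic circle, which is (c).

For (b), the same limit argument modulo `S(3q/2)` and all geodesic `3q`-lassos shows that these
generate a group containing `S(3p/2)`, hence `L(3p)`. It remains to replace `S(3q/2)` by `L(3q)`,
although small balls may carry wild loops (`lengthSubgroup_le_of_le_spanierSubgroup_sup`). The
monodromy of `Rips(X, q)` on the quotient by `L(3q)` and the circles does this: it is trivial on
`S(3q/2)`, because that dies in the Rips complex, while on Lipschitz loops it is the holonomy. Part
(d) follows formally from `spanierSubgroup_eq_sup`. -/

theorem continuous_realization_iff {f : Realization K → Z} :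
    Continuous f ↔ ∀ σ ∈ K.faces, Continuous fun w : ClosedSimplex K σ => f w.point := by
  simp only [continuous_def, isOpen_realization_iff]
  exact ⟨fun h σ hσ U hU => h U hU σ hσ, fun h U hU σ hσ => h σ hσ U hU⟩

theorem ClosedSimplex.continuous_weight {σ : Finset ι} (v : ι) :
    Continuous fun w : ClosedSimplex K σ => w.point.weight v :=
  (continuous_apply v).comp continuous_induced_dom

theorem ClosedSimplex.continuous_point {σ : Finset ι} (hσ : σ ∈ K.faces) :
    Continuous (ClosedSimplex.point : ClosedSimplex K σ → Realization K) :=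
  continuous_realization_iff.1 continuous_id σ hσ

/-- Every linear function of the barycentric coordinates is continuous. -/
theorem Realization.continuous_sum_mul (a : ι → ℝ) :
    Continuous fun w : Realization K => w.weight.sum fun v x => a v * x := by
  refine continuous_realization_iff.2 fun σ _ => ?_
  have h : (fun w : ClosedSimplex K σ => w.point.weight.sum fun v x => a v * x) =
      fun w => ∑ v ∈ σ, a v * w.point.weight v := by
    funext w
    exact Finsupp.sum_of_support_subset _ w.support_subset _ fun v _ => mul_zero _
  rw [h]
  exact continuous_finsetSum _ fun v _ =>
    continuous_const.mul (ClosedSimplex.continuous_weight v)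

theorem Realization.continuous_weight (v : ι) :
    Continuous fun w : Realization K => w.weight v :=
  continuous_realization_iff.2 fun _ _ => ClosedSimplex.continuous_weight v

/-- The open star of a vertex. -/
def Realization.star (K : AbstractSimplicialComplex ι) (v : ι) : Set (Realization K) :=
  {w | w.weight v ≠ 0}

theorem Realization.isOpen_star (v : ι) : IsOpen (Realization.star K v) :=
  isOpen_ne_fun (Realization.continuous_weight v) continuous_const

theorem Realization.support_nonempty (w : Realization K) : w.weight.support.Nonempty :=
  (K.isRelLowerSet_faces w.support_mem).1

theorem faces_mono {σ τ : Finset ι} (hτ : τ ∈ K.faces) (h : σ ⊆ τ) (hσ : σ.Nonempty) :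
    σ ∈ K.faces :=
  (K.isRelLowerSet_faces hτ).2 h hσ

@[simp]
theorem Realization.vertex_support (v : ι) :
    (Realization.vertex K v).weight.support = {v} :=
  Finsupp.support_single v one_ne_zero

/-- A map into the realization whose values are supported on a fixed finite set of vertices is
continuous as soon as its coordinates are. -/
theorem continuous_of_finite_support {f : Z → Realization K} {V : Finset ι}
    (hV : ∀ z, (f z).weight.support ⊆ V) (hf : ∀ v, Continuous fun z => (f z).weight v) :
    Continuous f := by
  classical
  -- There are finitely many faces inside `V`. The closed sets on which the support lies in a given
  -- one of them cover `Z`, and on each `f` factors through a closed simplex.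
  let S : Set (Finset ι) := {σ | σ ⊆ V ∧ σ ∈ K.faces}
  have hS : S.Finite := V.powerset.finite_toSet.subset fun σ hσ => by simpa using hσ.1
  have : Finite S := hS
  have hclosed : ∀ σ : S, IsClosed {z | (f z).weight.support ⊆ σ.1} := by
    intro σ
    have : {z | (f z).weight.support ⊆ σ.1} = ⋂ v ∈ {v | v ∉ σ.1}, {z | (f z).weight v = 0} := by
      ext z
      simp only [Set.mem_ofPred_eq, Set.mem_iInter, Finset.subset_iff, Finsupp.mem_support_iff]
      exact ⟨fun h v hv => by_contra fun h' => hv (h h'), fun h v hv => by_contra fun h' =>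
        hv (h v h')⟩
    rw [this]
    exact isClosed_biInter fun v _ => isClosed_eq (hf v) continuous_const
  refine (locallyFinite_of_finite fun σ : S => {z | (f z).weight.support ⊆ σ.1}).continuous
    ?_ hclosed fun σ => ?_
  · refine Set.eq_univ_of_forall fun z => Set.mem_iUnion.2
      ⟨⟨(f z).weight.support, hV z, (f z).support_mem⟩, ?_⟩
    exact Finset.Subset.refl _
  · rw [continuousOn_iff_continuous_domRestrict]
    have hc : Continuous fun z : {z | (f z).weight.support ⊆ σ.1} =>
        (⟨f z.1, z.2⟩ : ClosedSimplex K σ.1) := by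
      refine continuous_induced_rng.2 (continuous_pi fun v => ?_)
      exact (hf v).comp continuous_subtype_val
    exact (ClosedSimplex.continuous_point σ.2.2).comp hc

/-- A compact family of points of the realization is supported on finitely many vertices. -/
theorem exists_finite_support [CompactSpace Z] {f : Z → Realization K} (hf : Continuous f) :
    ∃ V : Finset ι, ∀ z, (f z).weight.support ⊆ V := by
  classical
  by_contra hcon
  have hinf : (⋃ z, ((f z).weight.support : Set ι)).Infinite := by
    intro hfin
    refine hcon ⟨hfin.toFinset, fun z v hv => ?_⟩
    rw [Set.Finite.mem_toFinset]
    exact Set.mem_iUnion.2 ⟨z, hv⟩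
  let e := hinf.natEmbedding
  have hz : ∀ n, ∃ z, (f z).weight (e n) ≠ 0 := fun n => by
    obtain ⟨z, hz⟩ := Set.mem_iUnion.1 (e n).2
    exact ⟨z, Finsupp.mem_support_iff.1 hz⟩
  choose z hz using hz
  have he : Function.Injective fun n => (e n : ι) := Subtype.val_injective.comp e.injective
  -- The coefficients are chosen so that the linear function takes a value of at least `n` at `f (z
  -- n)`, which contradicts boundedness on a compact space.
  let a : ι → ℝ := Function.extend (fun n => (e n : ι)) (fun n => n / (f (z n)).weight (e n)) 0
  have ha : ∀ n, a (e n) = n / (f (z n)).weight (e n) := fun n =>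
    he.extend_apply (fun n : ℕ => (n : ℝ) / (f (z n)).weight (e n)) 0 n
  have ha0 : ∀ v, 0 ≤ a v := by
    intro v
    by_cases h : ∃ n, (e n : ι) = v
    · obtain ⟨n, rfl⟩ := h
      rw [ha]
      exact div_nonneg n.cast_nonneg ((f (z n)).nonneg _)
    · exact (Function.extend_apply' (f := fun n => (e n : ι)) _ (0 : ι → ℝ) v h).ge
  have hg : Continuous fun z => (f z).weight.sum fun v x => a v * x :=
    (Realization.continuous_sum_mul (K := K) a).comp hf
  obtain ⟨C, hC⟩ := (isCompact_range hg).bddAbove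
  obtain ⟨n, hn⟩ := exists_nat_gt C
  have h1 : (f (z n)).weight.sum (fun v x => a v * x) ≤ C := hC (Set.mem_range_self (z n))
  have h2 : a (e n) * (f (z n)).weight (e n) ≤ (f (z n)).weight.sum fun v x => a v * x :=
    Finset.single_le_sum (f := fun v => a v * (f (z n)).weight v)
      (fun v _ => mul_nonneg (ha0 v) ((f (z n)).nonneg v))
      (Finsupp.mem_support_iff.2 (hz n))
  rw [ha, div_mul_cancel₀ _ (hz n)] at h2
  exact absurd (h2.trans h1) (not_le.2 hn)

/-! ### Contiguity and segments -/

/-- Two points of the realization are contiguous if a common closed simplex contains them. -/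
def Contig (a b : Realization K) : Prop :=
  ∃ τ ∈ K.faces, a.weight.support ⊆ τ ∧ b.weight.support ⊆ τ

theorem Contig.symm {a b : Realization K} (h : Contig a b) : Contig b a :=
  let ⟨τ, hτ, ha, hb⟩ := h
  ⟨τ, hτ, hb, ha⟩

theorem Contig.refl (a : Realization K) : Contig a a :=
  ⟨_, a.support_mem, Finset.Subset.refl _, Finset.Subset.refl _⟩

theorem Contig.of_mem {a : Realization K} {v : ι} (h : v ∈ a.weight.support) :
    Contig a (Realization.vertex K v) :=
  ⟨_, a.support_mem, Finset.Subset.refl _, by simpa using h⟩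

theorem lerp_support {a b : Realization K} {τ : Finset ι} (t : ℝ)
    (ha : a.weight.support ⊆ τ) (hb : b.weight.support ⊆ τ) :
    ((1 - t) • a.weight + t • b.weight).support ⊆ τ := by
  intro v hv
  by_contra h
  have h1 : a.weight v = 0 := by_contra fun h' => h (ha (Finsupp.mem_support_iff.2 h'))
  have h2 : b.weight v = 0 := by_contra fun h' => h (hb (Finsupp.mem_support_iff.2 h'))
  simp [h1, h2] at hv

/-- The point dividing the segment between two contiguous points in the ratio `t : 1 - t`. -/
def lerp {a b : Realization K} (h : Contig a b) (t : unitInterval) : Realization K where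
  weight := (1 - (t : ℝ)) • a.weight + (t : ℝ) • b.weight
  nonneg v := by
    have := a.nonneg v
    have := b.nonneg v
    have h1 : 0 ≤ 1 - (t : ℝ) := unitInterval.one_minus_nonneg t
    have h2 : 0 ≤ (t : ℝ) := unitInterval.nonneg t
    simp only [Finsupp.add_apply, Finsupp.smul_apply, smul_eq_mul]
    positivity
  sum_eq_one := by
    classical
    rw [Finsupp.sum_add_index' (fun _ => rfl) (fun _ _ _ => rfl),
      Finsupp.sum_smul_index (fun _ => rfl), Finsupp.sum_smul_index (fun _ => rfl)]
    have ha := a.sum_eq_one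
    have hb := b.sum_eq_one
    simp only [Finsupp.sum, ← Finset.mul_sum] at ha hb ⊢
    rw [ha, hb]
    ring
  support_mem := by
    obtain ⟨τ, hτ, ha, hb⟩ := h
    refine faces_mono hτ (lerp_support _ ha hb) ?_
    obtain ⟨v, hv⟩ : ∃ v, 0 < (1 - (t : ℝ)) * a.weight v + (t : ℝ) * b.weight v := by
      have hpos : ∀ w : Realization K, ∃ v, 0 < w.weight v := fun w => by
        obtain ⟨v, hv⟩ := w.support_nonempty
        exact ⟨v, lt_of_le_of_ne (w.nonneg v) (Finsupp.mem_support_iff.1 hv).symm⟩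
      rcases eq_or_lt_of_le (unitInterval.nonneg t) with h0 | h0
      · obtain ⟨v, hv⟩ := hpos a
        exact ⟨v, by simpa [← h0] using hv⟩
      · obtain ⟨v, hv⟩ := hpos b
        exact ⟨v, add_pos_of_nonneg_of_pos
          (mul_nonneg (unitInterval.one_minus_nonneg t) (a.nonneg v)) (mul_pos h0 hv)⟩
    exact ⟨v, by simpa using hv.ne'⟩

theorem lerp_zero {a b : Realization K} (h : Contig a b) : lerp h 0 = a := by
  ext v
  simp [lerp]

theorem lerp_one {a b : Realization K} (h : Contig a b) : lerp h 1 = b := by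
  ext v
  simp [lerp]

theorem lerp_self {a : Realization K} (h : Contig a a) (t : unitInterval) : lerp h t = a := by
  ext v
  simp only [lerp, Finsupp.add_apply, Finsupp.smul_apply, smul_eq_mul]
  ring

theorem continuous_lerp [CompactSpace Z] {f g : Z → Realization K} (hf : Continuous f)
    (hg : Continuous g) (h : ∀ z, Contig (f z) (g z)) :
    Continuous fun x : unitInterval × Z => lerp (h x.2) x.1 := by
  classical
  -- In the weak topology continuous coordinates suffice only on a finite set of vertices;
  -- compactness of `Z` provides one.
  obtain ⟨V, hV⟩ := exists_finite_support hf
  obtain ⟨W, hW⟩ := exists_finite_support hg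
  refine continuous_of_finite_support (V := V ∪ W) (fun x => lerp_support _
    ((hV _).trans Finset.subset_union_left) ((hW _).trans Finset.subset_union_right)) fun v => ?_
  have h1 := ((Realization.continuous_weight (K := K) v).comp hf).comp
    (continuous_snd (X := unitInterval) (Y := Z))
  have h2 := ((Realization.continuous_weight (K := K) v).comp hg).comp
    (continuous_snd (X := unitInterval) (Y := Z))
  have h3 : Continuous fun x : unitInterval × Z => (x.1 : ℝ) := by fun_prop
  simp only [lerp, Finsupp.add_apply, Finsupp.smul_apply, smul_eq_mul]
  exact ((continuous_const.sub h3).mul h1).add (h3.mul h2)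

/-- The straight segment between contiguous points. -/
def segPath {a b : Realization K} (h : Contig a b) : Path a b where
  toFun := lerp h
  continuous_toFun := by
    have h1 : Continuous fun x : unitInterval × Unit => lerp h x.1 :=
      continuous_lerp (Z := Unit) (f := fun _ => a) (g := fun _ => b)
        continuous_const continuous_const fun _ => h
    have h2 : Continuous fun t : unitInterval => (t, ()) := by fun_prop
    have h3 := h1.comp h2
    exact h3
  source' := lerp_zero h
  target' := lerp_one h

/-- The homotopy class of the straight segment between contiguous points. -/
def seg {a b : Realization K} (h : Contig a b) : Path.Homotopic.Quotient a b :=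
  .mk (segPath h)

/-- Pointwise contiguous paths with the same end points are homotopic. -/
theorem homotopic_of_contig {a b : Realization K} {f g : Path a b}
    (h : ∀ t, Contig (f t) (g t)) : f.Homotopic g :=
  ⟨{ toFun := fun x => lerp (h x.2) x.1
     continuous_toFun := continuous_lerp f.continuous g.continuous h
     map_zero_left := fun t => lerp_zero _
     map_one_left := fun t => lerp_one _
     prop' := by
      have key : ∀ {x y z : Realization K} (hxy : Contig x y) (t : unitInterval), x = z → y = z →
          lerp hxy t = z := by
        rintro x y z hxy t rfl rfl
        exact lerp_self _ _
      rintro t x (rfl | rfl)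
      · exact (key (h 0) t f.source g.source).trans f.source.symm
      · exact (key (h 1) t f.target g.target).trans f.target.symm }⟩

theorem segPath_support {a b : Realization K} (h : Contig a b) {τ : Finset ι}
    (ha : a.weight.support ⊆ τ) (hb : b.weight.support ⊆ τ) (t : unitInterval) :
    (segPath h t).weight.support ⊆ τ :=
  lerp_support _ ha hb

theorem segPath_contig_left {a b : Realization K} (h : Contig a b) (t : unitInterval) :
    Contig a (segPath h t) := by
  have ⟨τ, hτ, ha, hb⟩ := h
  exact ⟨τ, hτ, ha, segPath_support h ha hb t⟩

theorem segPath_contig_right {a b : Realization K} (h : Contig a b) (t : unitInterval) :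
    Contig b (segPath h t) := by
  have ⟨τ, hτ, ha, hb⟩ := h
  exact ⟨τ, hτ, hb, segPath_support h ha hb t⟩

theorem trans_pointwise {Y : Type*} [TopologicalSpace Y] {P : Y → Y → Prop}
    {x y z x' y' z' : Y} {γ : Path x y} {δ : Path y z} {γ' : Path x' y'} {δ' : Path y' z'}
    (h : ∀ t, P (γ t) (γ' t)) (h' : ∀ t, P (δ t) (δ' t)) (t : unitInterval) :
    P (γ.trans δ t) (γ'.trans δ' t) := by
  rw [Path.trans_apply, Path.trans_apply]
  split_ifs
  · exact h _
  · exact h' _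

/-- Pointwise contiguous paths are homotopic up to the segments joining their end points. -/
theorem mk_eq_of_contig {a b a' b' : Realization K} {f : Path a b} {g : Path a' b'}
    (h : ∀ t, Contig (f t) (g t)) (ha : Contig a a') (hb : Contig b' b) :
    Path.Homotopic.Quotient.mk f = (seg ha).trans ((Path.Homotopic.Quotient.mk g).trans (seg hb)) := by
  -- Padding `f` with constant paths gives both composites the same parametrization, so that they
  -- can be compared pointwise.
  have key : ((Path.refl a).trans (f.trans (Path.refl b))).Homotopic
      ((segPath ha).trans (g.trans (segPath hb))) := by
    refine homotopic_of_contig (trans_pointwise (fun t => ?_) (trans_pointwise h fun t => ?_))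
    · exact segPath_contig_left ha t
    · exact segPath_contig_right hb t
  have := Path.Homotopic.Quotient.eq.2 key
  simpa only [seg, Path.Homotopic.Quotient.mk_trans, Path.Homotopic.Quotient.mk_refl,
    Path.Homotopic.Quotient.refl_trans, Path.Homotopic.Quotient.trans_refl] using this

/-- A path inside one closed simplex is homotopic to a segment. -/
theorem mk_eq_seg {a b : Realization K} {f : Path a b} {τ : Finset ι} (hτ : τ ∈ K.faces)
    (h : ∀ t, (f t).weight.support ⊆ τ) (hab : Contig a b) :
    Path.Homotopic.Quotient.mk f = seg hab := by
  have ha : a.weight.support ⊆ τ := by simpa using h 0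
  have hb : b.weight.support ⊆ τ := by simpa using h 1
  exact Path.Homotopic.Quotient.eq.2
    (homotopic_of_contig fun t => ⟨τ, hτ, h t, segPath_support _ ha hb t⟩)

theorem seg_self {a : Realization K} (h : Contig a a) :
    seg h = Path.Homotopic.Quotient.refl a := by
  rw [← Path.Homotopic.Quotient.mk_refl]
  exact (mk_eq_seg a.support_mem (fun t => Finset.Subset.refl _) h).symm

/-- Segments inside one closed simplex compose. -/
theorem seg_trans {a b c : Realization K} {τ : Finset ι} (hτ : τ ∈ K.faces)
    (ha : a.weight.support ⊆ τ) (hb : b.weight.support ⊆ τ) (hc : c.weight.support ⊆ τ)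
    (hab : Contig a b) (hbc : Contig b c) (hac : Contig a c) :
    (seg hab).trans (seg hbc) = seg hac := by
  refine mk_eq_seg (f := (segPath hab).trans (segPath hbc)) hτ (fun t => ?_) hac
  rw [Path.trans_apply]
  split_ifs
  · exact segPath_support _ ha hb _
  · exact segPath_support _ hb hc _

theorem seg_symm {a b : Realization K} (h : Contig a b) :
    (seg h).symm = seg h.symm := by
  have ⟨τ, hτ, ha, hb⟩ := h
  have h1 := seg_trans hτ ha hb ha h h.symm (Contig.refl a)
  rw [seg_self] at h1
  calc (seg h).symm = (seg h).symm.trans ((seg h).trans (seg h.symm)) := by rw [h1]; simp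
    _ = seg h.symm := by
      rw [← Path.Homotopic.Quotient.trans_assoc, Path.Homotopic.Quotient.symm_trans,
        Path.Homotopic.Quotient.refl_trans]

/-- A path inside an open star contracts to the vertex. -/
theorem mk_eq_of_star {a b : Realization K} {f : Path a b} {v : ι}
    (h : ∀ t, f t ∈ Realization.star K v) (ha : Contig a (Realization.vertex K v))
    (hb : Contig (Realization.vertex K v) b) :
    Path.Homotopic.Quotient.mk f = (seg ha).trans (seg hb) := by
  rw [mk_eq_of_contig (g := Path.refl (Realization.vertex K v))
    (fun t => Contig.of_mem (Finsupp.mem_support_iff.2 (h t))) ha hb]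
  simp

end Realization

/-- A relation on parameters that is transitive and holds locally holds globally. -/
theorem unitInterval_chain {P : unitInterval → unitInterval → Prop}
    (htrans : ∀ a b c, a ≤ b → b ≤ c → P a b → P b c → P a c)
    (hloc : ∀ t, ∃ U ∈ 𝓝 t, ∀ a ∈ U, ∀ b ∈ U, a ≤ b → P a b) : P 0 1 := by
  choose U hU hP using hloc
  obtain ⟨t, h0, hm, ⟨n, hn⟩, ht⟩ := exists_monotone_Icc_subset_open_cover_unitInterval
    (c := fun s => interior (U s)) (fun _ => isOpen_interior)
    (fun s _ => Set.mem_iUnion.2 ⟨s, mem_interior_iff_mem_nhds.2 (hU s)⟩)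
  have key : ∀ k, P (t 0) (t k) := by
    intro k
    have step : ∀ k, P (t k) (t (k + 1)) := fun k => by
      obtain ⟨s, hs⟩ := ht k
      have hle := hm k.le_succ
      exact hP s _ (interior_subset (hs (Set.left_mem_Icc.2 hle))) _
        (interior_subset (hs (Set.right_mem_Icc.2 hle))) hle
    induction k with
    | zero =>
      -- Reflexivity is not assumed; it is the local hypothesis with `a = b`.
      obtain ⟨s, hs⟩ := ht 0
      have := interior_subset (hs (Set.left_mem_Icc.2 (hm (Nat.le_succ 0))))
      exact hP s _ this _ this le_rfl
    | succ k ih => exact htrans _ _ _ (hm k.zero_le) (hm k.le_succ) ih (step k)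
  have := key n
  rwa [h0, hn n le_rfl] at this

/-! ### The covering of the realization given by a cocycle on edges -/

section Covering

variable {ι Q : Type*} [Group Q] {K : AbstractSimplicialComplex ι}

/-- A function on pairs of vertices that is multiplicative on the simplices of `K`. -/
def IsEdgeCocycle (K : AbstractSimplicialComplex ι) (c : ι → ι → Q) : Prop :=
  ∀ τ ∈ K.faces, ∀ u ∈ τ, ∀ v ∈ τ, ∀ w ∈ τ, c u v * c v w = c u w

theorem IsEdgeCocycle.self {c : ι → ι → Q} (hc : IsEdgeCocycle K c) (v : ι) : c v v = 1 := by
  have h := hc {v} (K.singleton_mem v)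
  simpa using h v (by simp) v (by simp) v (by simp)

/-- A vertex of the smallest simplex that contains a given point. -/
def someVertex (w : Realization K) : ι :=
  w.support_nonempty.choose

theorem someVertex_mem (w : Realization K) : someVertex w ∈ w.weight.support :=
  w.support_nonempty.choose_spec

/-- The bundle with discrete fibre `Q`, trivial over the open stars, glued by a cocycle. -/
def cocycleBundle [TopologicalSpace Q] [DiscreteTopology Q] (c : ι → ι → Q)
    (hc : IsEdgeCocycle K c) : FiberBundleCore ι (Realization K) Q where
  baseSet v := Realization.star K v
  isOpen_baseSet := Realization.isOpen_star
  indexAt := someVertex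
  mem_baseSet_at w := Finsupp.mem_support_iff.1 (someVertex_mem w)
  coordChange u v _ g := g * c u v
  coordChange_self v _ _ g := by rw [hc.self, mul_one]
  continuousOn_coordChange u v :=
    ((continuous_of_discreteTopology (f := fun g : Q => g * c u v)).comp
      continuous_snd).continuousOn
  coordChange_comp u v w x hx g := by
    rw [mul_assoc, hc x.weight.support x.support_mem u (Finsupp.mem_support_iff.2 hx.1.1) v
      (Finsupp.mem_support_iff.2 hx.1.2) w (Finsupp.mem_support_iff.2 hx.2)]

/-- The monodromy of the covering defined by an edge cocycle: a functorial action of the path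
classes of the realization, given over an open star by the cocycle. -/
theorem exists_monodromy (c : ι → ι → Q) (hc : IsEdgeCocycle K c) :
    ∃ M : ∀ a b : Realization K, Path.Homotopic.Quotient a b → Q → Q,
      (∀ a g, M a a (.refl a) g = g) ∧
      (∀ a b d (p : Path.Homotopic.Quotient a b) (q : Path.Homotopic.Quotient b d) g,
        M a d (p.trans q) g = M b d q (M a b p g)) ∧
      (∀ a b (f : Path a b) v, (∀ t, v ∈ (f t).weight.support) → ∀ g,
        M a b (.mk f) g = g * c (someVertex a) v * c v (someVertex b)) := by
  let _ : TopologicalSpace Q := ⊥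
  have : DiscreteTopology Q := ⟨rfl⟩
  let Z := cocycleBundle c hc
  have cov : IsCoveringMap Z.proj := FiberBundle.isCoveringMap (F := Q) (E := Z.Fiber)
  let pt : ∀ a : Realization K, Q → Z.proj ⁻¹' {a} := fun a g => ⟨⟨a, g⟩, rfl⟩
  let co : ∀ a : Realization K, Z.proj ⁻¹' {a} → Q := fun a e => e.1.2
  have hpt : ∀ a e, pt a (co a e) = e := by
    rintro a ⟨⟨b, g⟩, rfl⟩
    rfl
  refine ⟨fun a b p g => co b (cov.monodromy p (pt a g)), fun a g => ?_, fun a b d p q g => ?_,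
    fun a b f v hf g => ?_⟩
  · beta_reduce
    rw [cov.monodromy_refl]
    rfl
  · beta_reduce
    rw [cov.monodromy_trans_apply, hpt]
  -- The fibre coordinate over a point refers to the chart of its `someVertex`. The lift that is
  -- constant equal to `g'` in the chart `v` therefore acquires the factor `c v _`.
  · let g' := g * c (someVertex a) v
    let Γ : unitInterval → Z.TotalSpace := fun t => ⟨f t, g' * c v (someVertex (f t))⟩
    have hΓ : Continuous Γ := by
      have h1 : ContinuousOn (Z.localTriv v).toOpenPartialHomeomorph.symm
          (Z.localTriv v).toOpenPartialHomeomorph.target :=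
        (Z.localTriv v).toOpenPartialHomeomorph.continuousOn_symm
      refine h1.comp_continuous (f := fun t => (f t, g')) (by fun_prop) fun t => ?_
      exact (Z.mem_localTriv_target v _).2 (Finsupp.mem_support_iff.1 (hf t))
    have h0 : Γ 0 = (pt a g).1 := by
      have hg : g' * c v (someVertex a) = g := by
        have ha : v ∈ a.weight.support := by simpa using hf 0
        rw [mul_assoc, hc _ a.support_mem _ (someVertex_mem a) _ ha _ (someVertex_mem a), hc.self,
          mul_one]
      have : ∀ x, x = a → (⟨x, g' * c v (someVertex x)⟩ : Z.TotalSpace) = ⟨a, g⟩ := by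
        rintro x rfl
        rw [hg]
      exact this _ f.source
    have hlift := (cov.eq_liftPath_iff (γ := f.toContinuousMap) (e := (pt a g).1)
      f.source).2 ⟨hΓ, rfl, h0⟩
    have h1 : (cov.monodromy (.mk f) (pt a g)).1 = Γ 1 := (congrFun hlift 1).symm
    have : ∀ e : Z.TotalSpace, e = Γ 1 → (e.2 : Q) = g' * c v (someVertex b) := by
      rintro e rfl
      have : someVertex (f 1) = someVertex b := by rw [f.target]
      change g' * c v (someVertex (f 1)) = _
      rw [this]
    exact this _ h1

end Covering

open Path.Homotopic (Quotient)

/-! ### Chopping paths into small pieces -/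

section Chain

variable {Y : Type*} [TopologicalSpace Y]

/-- A property of path classes that is closed under composition and holds for all short pieces of
a path holds for the path. -/
theorem path_chain {P : ∀ x y : Y, Quotient x y → Prop}
    (htrans : ∀ x y z (p : Quotient x y) (q : Quotient y z), P x y p → P y z q → P x z (p.trans q))
    {x y : Y} (γ : Path x y)
    (hloc : ∀ t, ∃ U ∈ 𝓝 t, ∀ a ∈ U, ∀ b ∈ U, a ≤ b → P _ _ (.mk (γ.subpath a b))) :
    P x y (.mk γ) := by
  have h : P _ _ (.mk (γ.subpath 0 1)) := by
    refine unitInterval_chain (P := fun a b => P _ _ (.mk (γ.subpath a b)))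
      (fun a b c _ _ h h' => ?_) hloc
    have hc : Path.Homotopic _ _ := ⟨Path.Homotopy.subpathTransSubpath γ a b c⟩
    have := htrans _ _ _ _ _ h h'
    rwa [← Quotient.mk_trans, Path.Homotopic.Quotient.eq.2 hc] at this
  have key : ∀ {x' y' : Y} (hx : x' = x) (hy : y' = y), P x' y' (.mk (γ.cast hx hy)) →
      P x y (.mk γ) := by
    rintro _ _ rfl rfl h
    exact h
  rw [Path.subpath_zero_one] at h
  exact key _ _ h

theorem Quotient.symm_trans_cancel {x y z : Y} (p : Quotient x y) (q : Quotient y z) :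
    p.symm.trans (p.trans q) = q := by
  rw [← Quotient.trans_assoc, Quotient.symm_trans, Quotient.refl_trans]

theorem Quotient.trans_symm_cancel {x y z : Y} (p : Quotient x y) (q : Quotient x z) :
    p.trans (p.symm.trans q) = q := by
  rw [← Quotient.trans_assoc, Quotient.trans_symm, Quotient.refl_trans]

theorem Quotient.trans_left_cancel {x y z : Y} {p : Quotient x y} {q q' : Quotient y z}
    (h : p.trans q = p.trans q') : q = q' := by
  rw [← Quotient.symm_trans_cancel p q, h, Quotient.symm_trans_cancel]

theorem Quotient.symm_symm {x y : Y} (p : Quotient x y) : p.symm.symm = p := by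
  induction p with
  | mk p => rw [← Quotient.mk_symm, ← Quotient.mk_symm, Path.symm_symm]

theorem Quotient.symm_trans_rev {x y z : Y} (p : Quotient x y) (q : Quotient y z) :
    (p.trans q).symm = q.symm.trans p.symm := by
  induction p with
  | mk p =>
    induction q with
    | mk q => rw [← Quotient.mk_trans, ← Quotient.mk_symm, Path.trans_symm]; rfl

theorem Quotient.map_trans {Y' : Type*} [TopologicalSpace Y'] {x y z : Y} (p : Quotient x y)
    (q : Quotient y z) (f : C(Y, Y')) : (p.trans q).map f = (p.map f).trans (q.map f) := by
  induction p with
  | mk p =>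
    induction q with
    | mk q =>
      rw [← Quotient.mk_trans, ← Quotient.mk_map, Path.map_trans]
      rfl

/-- Short pieces of a path in a metric space are small. -/
theorem exists_nhds_subpath_dist {X : Type*} [PseudoMetricSpace X] {x y : X} (γ : Path x y)
    (t : unitInterval) {η : ℝ} (hη : 0 < η) :
    ∃ U ∈ 𝓝 t, ∀ a ∈ U, ∀ b ∈ U, ∀ s, dist (γ.subpath a b s) (γ a) < η := by
  obtain ⟨δ, hδ, h⟩ := Metric.continuousAt_iff.1 (γ.continuous.continuousAt (x := t)) (η / 2)
    (half_pos hη)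
  refine ⟨Metric.ball t δ, Metric.ball_mem_nhds _ hδ, fun a ha b hb s => ?_⟩
  have hs : γ.subpath a b s ∈ γ '' Set.uIcc a b := by
    rw [← Path.range_subpath]
    exact Set.mem_range_self s
  obtain ⟨u, hu, hus⟩ := hs
  have hut : dist u t < δ := by
    rw [Metric.mem_ball, Subtype.dist_eq, Real.dist_eq, abs_lt] at ha hb
    rw [Subtype.dist_eq, Real.dist_eq, abs_lt]
    rcases Set.mem_uIcc.1 hu with ⟨h1, h2⟩ | ⟨h1, h2⟩ <;>
    · have h1' : (_ : ℝ) ≤ _ := h1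
      have h2' : (_ : ℝ) ≤ _ := h2
      constructor <;> linarith
  rw [← hus]
  linarith [dist_triangle_right (γ u) (γ a) (γ t), h hut, h ha]

end Chain

/-! ### Edge paths in the Rips complex -/

section Rips

variable {X : Type*} [MetricSpace X] {r : ℝ} {hr : 0 < r}

/-- A finite set attains its diameter at some pair, so strict pairwise bounds give a strict bound on
the diameter. -/
theorem mem_rips_faces {σ : Finset X} (hσ : σ.Nonempty) (h : ∀ x ∈ σ, ∀ y ∈ σ, dist x y < r) :
    σ ∈ (rips X r hr).faces := by
  refine ⟨hσ, ?_⟩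
  obtain ⟨p, hp, hmax⟩ := (σ ×ˢ σ).exists_max_image (fun p => dist p.1 p.2) (hσ.product hσ)
  rw [Finset.mem_product] at hp
  refine lt_of_le_of_lt (Metric.diam_le_of_forall_dist_le dist_nonneg fun x hx y hy => ?_)
    (h _ hp.1 _ hp.2)
  exact hmax (x, y) (Finset.mem_product.2 ⟨hx, hy⟩)

theorem dist_lt_of_mem_rips_faces {σ : Finset X} (h : σ ∈ (rips X r hr).faces) {x y : X}
    (hx : x ∈ σ) (hy : y ∈ σ) : dist x y < r :=
  (Metric.dist_le_diam_of_mem σ.finite_toSet.isBounded hx hy).trans_lt h.2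

theorem mem_rips_faces_of_near {σ : Finset X} (hσ : σ.Nonempty) (x : X)
    (h : ∀ y ∈ σ, dist x y < r / 2) : σ ∈ (rips X r hr).faces :=
  mem_rips_faces hσ fun y hy z hz => by
    linarith [dist_triangle_left y z x, h y hy, h z hz]

theorem contig_vertex {x y : X} (h : dist x y < r) :
    Contig (Realization.vertex (rips X r hr) x) (Realization.vertex _ y) := by
  classical
  refine ⟨{x, y}, mem_rips_faces (by simp) ?_, by simp, by simp⟩
  simp [dist_comm y x, h, hr]

/-- The edge path between two vertices at distance less than `r`. -/
def edge (hr : 0 < r) {x y : X} (h : dist x y < r) :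
    Quotient (Realization.vertex (rips X r hr) x) (Realization.vertex _ y) :=
  seg (contig_vertex h)

theorem edge_trans {x y z : X} (hxy : dist x y < r) (hyz : dist y z < r) (hxz : dist x z < r) :
    (edge hr hxy).trans (edge hr hyz) = edge hr hxz := by
  classical
  refine seg_trans (τ := {x, y, z}) (mem_rips_faces (by simp) ?_) (by simp) (by simp) (by simp)
    _ _ _
  simp [dist_comm y x, dist_comm z x, dist_comm z y, hxy, hyz, hxz, hr]

theorem edge_self {x : X} (h : dist x x < r) : edge hr h = Quotient.refl _ :=
  seg_self _

/-! ### Comparing a space with its Rips complex -/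

/-- A continuous map from `X` to the Rips complex that moves each point only slightly. -/
structure FineMap (X : Type*) [MetricSpace X] (r : ℝ) (hr : 0 < r) where
  map : C(X, Realization (rips X r hr))
  near : ∀ x, ∀ v ∈ (map x).weight.support, dist x v < r / 10

/-- A partition of unity made of tent functions around a finite `r / 10`-net serves as barycentric
coordinates. -/
theorem exists_fineMap (X : Type*) [MetricSpace X] [CompactSpace X] (r : ℝ) (hr : 0 < r) :
    Nonempty (FineMap X r hr) := by
  classical
  obtain ⟨S, -, hS, hcov⟩ := finite_cover_balls_of_compact (X := X) isCompact_univ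
    (e := r / 10) (by positivity)
  lift S to Finset X using hS
  let b : X → X → ℝ := fun x v => if v ∈ S then max 0 (r / 10 - dist x v) else 0
  have hb0 : ∀ x v, 0 ≤ b x v := fun x v => by
    simp only [b]
    split_ifs
    · exact le_max_left _ _
    · exact le_rfl
  have hbS : ∀ x v, b x v ≠ 0 → v ∈ S ∧ dist x v < r / 10 := fun x v h => by
    simp only [b] at h
    split_ifs at h with hv
    · refine ⟨hv, ?_⟩
      by_contra hd
      exact h (max_eq_left (by linarith))
    · exact absurd rfl h
  have hbc : ∀ v, Continuous fun x => b x v := fun v => by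
    by_cases hv : v ∈ S
    · simp only [b, hv, if_true]
      fun_prop
    · simp only [b, hv, if_false]
      fun_prop
  let T : X → ℝ := fun x => ∑ v ∈ S, b x v
  have hT : ∀ x, 0 < T x := fun x => by
    obtain ⟨v, hv, hxv⟩ := Set.mem_iUnion₂.1 (hcov (Set.mem_univ x))
    refine Finset.sum_pos' (fun v _ => hb0 x v) ⟨v, hv, ?_⟩
    have hv' : v ∈ S := hv
    simp only [b, hv', if_true]
    exact lt_max_of_lt_right (by simpa using hxv)
  let wt : X → X →₀ ℝ := fun x => Finsupp.onFinset S (fun v => b x v / T x) fun v hv =>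
    (hbS x v fun h => hv (by rw [h, zero_div])).1
  have hwt : ∀ x v, v ∈ (wt x).support → dist x v < r / 10 := fun x v hv =>
    (hbS x v fun h => Finsupp.mem_support_iff.1 hv (by
      simp only [wt, Finsupp.onFinset_apply, h, zero_div])).2
  have hsum : ∀ x, ((wt x).sum fun _ a => a) = 1 := fun x => by
    rw [Finsupp.onFinset_sum _ fun _ => rfl, ← Finset.sum_div, div_self (hT x).ne']
  let f : X → Realization (rips X r hr) := fun x =>
    { weight := wt x
      nonneg := fun v => div_nonneg (hb0 x v) (hT x).le
      sum_eq_one := hsum x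
      support_mem := by
        refine mem_rips_faces_of_near ?_ x fun v hv => ?_
        · by_contra h
          have := hsum x
          rw [Finset.not_nonempty_iff_eq_empty, Finsupp.support_eq_empty] at h
          simp [h] at this
        · linarith [hwt x v hv] }
  have hf : Continuous f := by
    refine continuous_of_finite_support (V := S) (fun x v hv => ?_) fun v => ?_
    · exact (hbS x v fun h => Finsupp.mem_support_iff.1 hv (by
        simp only [f, wt, Finsupp.onFinset_apply, h, zero_div])).1
    · exact (hbc v).div (continuous_finsetSum _ fun v _ => hbc v) fun x => (hT x).ne'
  exact ⟨⟨⟨f, hf⟩, hwt⟩⟩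

namespace FineMap

variable (Φ : FineMap X r hr)

theorem contig (x : X) : Contig (Realization.vertex _ x) (Φ.map x) := by
  classical
  refine ⟨insert x (Φ.map x).weight.support, mem_rips_faces_of_near (by simp) x fun y hy => ?_,
    by simp, Finset.subset_insert _ _⟩
  rcases Finset.mem_insert.1 hy with rfl | hy
  · simpa using half_pos hr
  · linarith [Φ.near x y hy]

/-- The path class in the Rips complex, between vertices, induced by a path class of `X`. -/
def hat {x y : X} (q : Quotient x y) :
    Quotient (Realization.vertex (rips X r hr) x) (Realization.vertex _ y) :=
  (seg (Φ.contig x)).trans ((q.map Φ.map).trans (seg (Φ.contig y).symm))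

theorem hat_refl (x : X) : Φ.hat (Quotient.refl x) = Quotient.refl _ := by
  have : (Quotient.refl x).map Φ.map = Quotient.refl _ := rfl
  rw [hat, this, Quotient.refl_trans, ← seg_symm (Φ.contig x), Quotient.trans_symm]

theorem hat_trans {x y z : X} (p : Quotient x y) (q : Quotient y z) :
    Φ.hat (p.trans q) = (Φ.hat p).trans (Φ.hat q) := by
  simp only [hat, Quotient.map_trans, Quotient.trans_assoc, ← seg_symm (Φ.contig y),
    Quotient.symm_trans_cancel]

theorem hat_symm {x y : X} (p : Quotient x y) : Φ.hat p.symm = (Φ.hat p).symm := by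
  refine Quotient.trans_left_cancel (p := Φ.hat p) ?_
  rw [← hat_trans, Quotient.trans_symm, hat_refl, Quotient.trans_symm]

/-- Short paths are mapped to edges. -/
theorem hat_mk_of_small {x y : X} {γ : Path x y} (h : ∀ t, dist (γ t) x < r / 5)
    (hd : dist x y < r) : Φ.hat (.mk γ) = edge hr hd := by
  classical
  -- The vertices of `Φ.map z` are within `r / 10 + r / 5 < r / 2` of `x`, so together with `x` they
  -- span a simplex.
  have hc : ∀ z, dist z x < r / 5 → Contig (Φ.map z) (Realization.vertex _ x) := fun z hz => by
    refine ⟨insert x (Φ.map z).weight.support, mem_rips_faces_of_near (by simp) x fun v hv => ?_,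
      Finset.subset_insert _ _, by simp⟩
    rcases Finset.mem_insert.1 hv with rfl | hv
    · simpa using half_pos hr
    · linarith [Φ.near z v hv, dist_triangle_left x v z]
  have hy : dist y x < r / 5 := by simpa using h 1
  have key := mk_eq_of_contig (f := γ.map Φ.map.continuous)
    (g := Path.refl (Realization.vertex (rips X r hr) x)) (fun t => hc _ (h t))
    (Φ.contig x).symm (hc y hy).symm
  have hτ : insert x (insert y (Φ.map y).weight.support) ∈ (rips X r hr).faces := by
    refine mem_rips_faces_of_near (by simp) y fun v hv => ?_
    rcases Finset.mem_insert.1 hv with rfl | hv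
    · linarith
    rcases Finset.mem_insert.1 hv with rfl | hv
    · simpa using half_pos hr
    · linarith [Φ.near y v hv]
  rw [hat, ← Quotient.mk_map, key, ← seg_symm (Φ.contig x), Quotient.trans_assoc,
    Quotient.trans_symm_cancel, Quotient.mk_refl, Quotient.refl_trans]
  exact seg_trans hτ (by simp) ((Finset.subset_insert _ _).trans (Finset.subset_insert _ _))
    (by simp) _ _ _

/-- A family of path classes `e y` from a fixed point to the vertices `y ∈ S`, compatible with
short edges, is compatible with the images of all paths inside `S`. -/
theorem trans_hat_of_family {c : Realization (rips X r hr)} {S : Set X}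
    (e : ∀ y ∈ S, Quotient c (Realization.vertex _ y)) {η : ℝ} (hη : 0 < η)
    (he : ∀ y y' (hy : y ∈ S) (hy' : y' ∈ S) (hd : dist y y' < r), dist y y' < η →
      (e y hy).trans (edge hr hd) = e y' hy')
    {x y : X} (γ : Path x y) (hγ : ∀ t, γ t ∈ S) (hx : x ∈ S) (hy : y ∈ S) :
    (e x hx).trans (Φ.hat (.mk γ)) = e y hy := by
  have key := path_chain (P := fun x y q => ∃ (hx : x ∈ S) (hy : y ∈ S),
    (e x hx).trans (Φ.hat q) = e y hy) (fun x y z p q ⟨hx, hy, hp⟩ ⟨_, hz, hq⟩ =>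
      ⟨hx, hz, by rw [Φ.hat_trans, ← Quotient.trans_assoc, hp, hq]⟩) γ fun t => by
    obtain ⟨U, hU, h⟩ := exists_nhds_subpath_dist γ t (lt_min hη (by positivity : 0 < r / 5))
    refine ⟨U, hU, fun a ha b hb _ => ⟨hγ a, hγ b, ?_⟩⟩
    have hab : dist (γ a) (γ b) < min η (r / 5) := by
      rw [dist_comm]
      simpa using h a ha b hb 1
    have hd : dist (γ a) (γ b) < r := by linarith [hab.trans_le (min_le_right _ _)]
    rw [Φ.hat_mk_of_small (fun s => (h a ha b hb s).trans_le (min_le_right _ _)) hd]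
    exact he _ _ _ _ _ (hab.trans_le (min_le_left _ _))
  exact key.2.2

/-- A path inside the ball of radius `r` around its initial point is mapped to an edge. -/
theorem hat_mk_of_ball {x y : X} (γ : Path x y) (h : ∀ t, dist x (γ t) < r) (hd : dist x y < r) :
    Φ.hat (.mk γ) = edge hr hd := by
  have hx : dist x x < r := by simpa using hr
  have := Φ.trans_hat_of_family (S := {y | dist x y < r}) (fun y hy => edge hr hy) hr
    (fun y y' hy hy' hd _ => edge_trans hy hd hy') γ h hx hd
  rwa [edge_self, Quotient.refl_trans] at this

/-- Loops in balls of radius less than `3 * r / 2` become null-homotopic in the Rips complex. -/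
theorem hat_mk_of_closedBall (hX : IsGeodesicSpace X) {y w : X} {d : ℝ} (hd : d < 3 * r / 2)
    (β : Path y y) (hβ : Set.range β ⊆ Metric.closedBall w d) :
    Φ.hat (.mk β) = Quotient.refl _ := by
  -- The radius may exceed `r`, so `z` need not be adjacent to the centre. The point two thirds of
  -- the way along a geodesic is a relay: its distance to the centre is at most `2 * d / 3 < r`, and
  -- its distance to `z` at most `d / 3`.
  have hm : ∀ z ∈ Metric.closedBall w d, ∃ m, dist w m ≤ 2 * d / 3 ∧ dist m z ≤ d / 3 := by
    intro z hz
    rw [Metric.mem_closedBall, dist_comm] at hz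
    obtain ⟨f, h0, h1, hf⟩ := hX w z
    have hn : 0 ≤ dist w z := dist_nonneg
    have hmem : 2 * dist w z / 3 ∈ Set.Icc 0 (dist w z) := ⟨by linarith, by linarith⟩
    refine ⟨f (2 * dist w z / 3), ?_, ?_⟩
    · have := hf _ ⟨le_rfl, hn⟩ _ hmem
      rw [h0, abs_sub_comm, abs_of_nonneg (by linarith)] at this
      linarith
    · have := hf _ hmem _ ⟨hn, le_rfl⟩
      rw [h1, abs_sub_comm, abs_of_nonneg (by linarith)] at this
      linarith
  choose m hwm hmz using hm
  have hd0 : ∀ z ∈ Metric.closedBall w d, 0 ≤ d := fun z hz => dist_nonneg.trans hz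
  have hwm' : ∀ z hz, dist w (m z hz) < r := fun z hz => by linarith [hwm z hz, hd0 z hz]
  have hmz' : ∀ z hz, dist (m z hz) z < r := fun z hz => by linarith [hmz z hz, hd0 z hz]
  have hy : y ∈ Metric.closedBall w d := hβ ⟨0, β.source⟩
  -- The paths `w → m z → z` cone off the ball. Relays of two points closer than `η` are less than
  -- `2 * d / 3 + η` apart, and `η` is half of the slack `r - 2 * d / 3`.
  have key := Φ.trans_hat_of_family (S := Metric.closedBall w d)
    (fun z hz => (edge hr (hwm' z hz)).trans (edge hr (hmz' z hz)))
    (η := (r - 2 * d / 3) / 2) (by linarith) (fun z z' hz hz' hzz hη => by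
      have h0 := hd0 z hz
      have h1 : dist (m z hz) z' < r := by
        linarith [dist_triangle (m z hz) z z', hmz z hz]
      have h2 : dist (m z hz) (m z' hz') < r := by
        linarith [dist_triangle_right (m z hz) (m z' hz') z', dist_triangle (m z hz) z z',
          hmz z hz, hmz z' hz']
      rw [Quotient.trans_assoc, edge_trans _ _ h1, ← edge_trans (hwm' z hz) h2 (hwm' z' hz'),
        Quotient.trans_assoc, edge_trans h2 _ h1])
    β (fun t => hβ ⟨t, rfl⟩) hy hy
  refine Quotient.trans_left_cancel (p := (edge hr (hwm' y hy)).trans (edge hr (hmz' y hy))) ?_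
  rw [key, Quotient.trans_refl]

/-- Every path class between vertices of the Rips complex comes from `X`. -/
theorem hat_surjective (hgeo : ∀ x y : X, ∃ γ : Path x y, ∀ t, dist x (γ t) ≤ dist x y) {u v : X}
    (q : Quotient (Realization.vertex (rips X r hr) u) (Realization.vertex _ v)) :
    ∃ p : Quotient u v, Φ.hat p = q := by
  induction q with
  | mk f =>
  have hedge : ∀ {x y : X} (hd : dist x y < r), ∃ p : Quotient x y, Φ.hat p = edge hr hd := by
    intro x y hd
    obtain ⟨γ, hγ⟩ := hgeo x y
    exact ⟨.mk γ, Φ.hat_mk_of_ball γ (fun t => (hγ t).trans_lt hd) hd⟩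
  -- Interior points of a path are not vertices, so the lifting claim is made for every choice of
  -- vertices of the simplices carrying the end points.
  have key := path_chain (P := fun a b (q : Quotient a b) =>
    ∀ u (hu : u ∈ a.weight.support) v (hv : v ∈ b.weight.support), ∃ p : Quotient u v,
      Φ.hat p = (seg (Contig.of_mem hu).symm).trans (q.trans (seg (Contig.of_mem hv)))) ?_ f ?_
  · obtain ⟨p, hp⟩ := key u (by simp) v (by simp)
    refine ⟨p, ?_⟩
    rw [hp, seg_self, seg_self, Quotient.refl_trans, Quotient.trans_refl]
  · intro a b d p q hp hq u hu v hv
    obtain ⟨w, hw⟩ := b.support_nonempty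
    obtain ⟨p', hp'⟩ := hp u hu w hw
    obtain ⟨q', hq'⟩ := hq w hw v hv
    refine ⟨p'.trans q', ?_⟩
    rw [hat_trans, hp', hq']
    simp only [Quotient.trans_assoc, ← seg_symm (Contig.of_mem hw), Quotient.trans_symm_cancel]
  · intro t
    obtain ⟨w, hw⟩ := (f t).support_nonempty
    have hU : f ⁻¹' Realization.star _ w ∈ 𝓝 t :=
      ((Realization.isOpen_star w).preimage f.continuous).mem_nhds (Finsupp.mem_support_iff.1 hw)
    obtain ⟨U, hU, h⟩ : ∃ U ∈ 𝓝 t, ∀ a ∈ U, ∀ b ∈ U, ∀ s,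
        f.subpath a b s ∈ Realization.star (rips X r hr) w := by
      obtain ⟨δ, hδ, h⟩ := Metric.mem_nhds_iff.1 hU
      -- Applied to the identity path of the interval, this bounds the parameters that a short
      -- subpath visits, so that it stays in the star of `w`.
      obtain ⟨U, hU, h'⟩ := exists_nhds_subpath_dist (X := unitInterval)
        (⟨ContinuousMap.id _, rfl, rfl⟩ : Path (0 : unitInterval) 1) t (half_pos hδ)
      refine ⟨U ∩ Metric.ball t (δ / 2), Filter.inter_mem hU (Metric.ball_mem_nhds _ (half_pos hδ)),
        fun a ha b hb s => h ?_⟩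
      have h1 : dist (Set.Icc.convexComb a b s) a < δ / 2 := h' a ha.1 b hb.1 s
      have h2 : dist a t < δ / 2 := ha.2
      rw [Metric.mem_ball]
      linarith [dist_triangle (Set.Icc.convexComb a b s) a t]
    refine ⟨U, hU, fun a ha b hb _ u hu v hv => ?_⟩
    have hwa : w ∈ (f a).weight.support := Finsupp.mem_support_iff.2 (by
      have := h a ha b hb 0
      rwa [Path.source] at this)
    have hwb : w ∈ (f b).weight.support := Finsupp.mem_support_iff.2 (by
      have := h a ha b hb 1
      rwa [Path.target] at this)
    have huw := dist_lt_of_mem_rips_faces (f a).support_mem hu hwa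
    have hwv := dist_lt_of_mem_rips_faces (f b).support_mem hwb hv
    obtain ⟨p, hp⟩ := hedge huw
    obtain ⟨q, hq⟩ := hedge hwv
    refine ⟨p.trans q, ?_⟩
    rw [hat_trans, hp, hq, mk_eq_of_star (h a ha b hb) (Contig.of_mem hwa)
      (Contig.of_mem hwb).symm, Quotient.trans_assoc, ← Quotient.trans_assoc (seg _) (seg _) _]
    congr 1
    · exact (seg_trans (f a).support_mem (by simpa using hu) (Finset.Subset.refl _)
        (by simpa using hwa) _ _ _).symm
    · exact (seg_trans (f b).support_mem (by simpa using hwb) (Finset.Subset.refl _)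
        (by simpa using hv) _ _ _).symm

/-- A fine map for a scale is also one for each larger scale. -/
def incl {s : ℝ} (h : r ≤ s) : FineMap X s (hr.trans_le h) where
  map := (Realization.inclusion (rips_mono hr h)).comp Φ.map
  near x v hv := (Φ.near x v hv).trans_le (by linarith)

theorem hat_incl {s : ℝ} (h : r ≤ s) {x y : X} (q : Quotient x y) :
    (Φ.incl h).hat q = (Φ.hat q).map (Realization.inclusion (rips_mono hr h)) := by
  rw [hat, hat, Quotient.map_trans, Quotient.map_trans, ← Quotient.map_comp]
  rfl

end FineMap

end Rips

/-! ### Lengths of paths -/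

section Length

variable {X : Type*} [MetricSpace X]

/-- The path `γ` is Lipschitz with constant `l`. -/
def IsLipPath (l : ℝ) {x y : X} (γ : Path x y) : Prop :=
  ∀ s t : unitInterval, dist (γ s) (γ t) ≤ l * dist s t

theorem unitInterval_dist_le_one (s t : unitInterval) : dist s t ≤ 1 := by
  rw [Subtype.dist_eq, Real.dist_eq, abs_le]
  have := s.2.1
  have := s.2.2
  have := t.2.1
  have := t.2.2
  constructor <;> linarith

theorem univ_inter_Icc_zero_one : Set.univ ∩ Set.Icc (0 : unitInterval) 1 = Set.univ := by
  ext t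
  exact ⟨fun _ => trivial, fun _ => ⟨trivial, unitInterval.nonneg', unitInterval.le_one'⟩⟩

theorem exists_geodesic_path (hX : IsGeodesicSpace X) (x y : X) :
    ∃ γ : Path x y, IsLipPath (dist x y) γ := by
  obtain ⟨f, h0, h1, hf⟩ := hX x y
  have hd : 0 ≤ dist x y := dist_nonneg
  have hmem : ∀ t : unitInterval, dist x y * t ∈ Set.Icc 0 (dist x y) := fun t =>
    ⟨mul_nonneg hd t.2.1, mul_le_of_le_one_right hd t.2.2⟩
  have hlip : ∀ s t : unitInterval, dist (f (dist x y * s)) (f (dist x y * t)) =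
      dist x y * dist s t := fun s t => by
    rw [hf _ (hmem s) _ (hmem t), ← mul_sub, abs_mul, abs_of_nonneg hd]
    rfl
  refine ⟨⟨⟨fun t => f (dist x y * t), ?_⟩, by simpa using h0, by simpa using h1⟩,
    fun s t => (hlip s t).le⟩
  exact (LipschitzWith.of_dist_le_mul (K := ⟨dist x y, hd⟩) fun s t => (hlip s t).le).continuous

theorem IsLipPath.mono {l l' : ℝ} (h : l ≤ l') {x y : X} {γ : Path x y} (hγ : IsLipPath l γ) :
    IsLipPath l' γ := fun s t =>
  (hγ s t).trans (mul_le_mul_of_nonneg_right h dist_nonneg)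

theorem IsLipPath.dist_left_le {l : ℝ} (hl : 0 ≤ l) {x y : X} {γ : Path x y} (hγ : IsLipPath l γ)
    (t : unitInterval) : dist x (γ t) ≤ l := by
  have := hγ 0 t
  rw [γ.source] at this
  exact this.trans (mul_le_of_le_one_right hl (unitInterval_dist_le_one _ _))

theorem pathLength_le_of_isLipPath {l : ℝ} {x y : X} {γ : Path x y} (h : IsLipPath l γ) :
    pathLength γ ≤ ENNReal.ofReal l := by
  have h1 : LipschitzWith l.toNNReal γ := LipschitzWith.of_dist_le_mul fun s t =>
    (h s t).trans (mul_le_mul_of_nonneg_right (Real.le_coe_toNNReal l) dist_nonneg)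
  have h2 := (h1.lipschitzOnWith (s := Set.univ)).comp_eVariationOn_le
    (Set.mapsTo_univ (id : unitInterval → unitInterval) Set.univ)
  have h3 : eVariationOn (id : unitInterval → unitInterval) Set.univ ≤ 1 := by
    have hm : MonotoneOn (Subtype.val : unitInterval → ℝ) Set.univ := fun _ _ _ _ h => h
    have := (hm.eVariationOn_eq (Set.mem_univ 0) (Set.mem_univ 1)).le
    rw [univ_inter_Icc_zero_one] at this
    refine le_trans (le_of_eq ?_) (this.trans (by simp))
    rfl
  calc pathLength γ ≤ l.toNNReal * eVariationOn (id : unitInterval → unitInterval) Set.univ := h2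
    _ ≤ l.toNNReal * 1 := by gcongr
    _ = ENNReal.ofReal l := by rw [mul_one]; rfl

theorem pathLength_symm_le {x y : X} (γ : Path x y) : pathLength γ.symm ≤ pathLength γ :=
  eVariationOn.comp_le_of_antitoneOn γ unitInterval.symm
    (fun _ _ _ _ h => unitInterval.symm_le_symm.2 h) (Set.mapsTo_univ _ _)

theorem pathLength_trans_le {x y z : X} (γ : Path x y) (δ : Path y z) :
    pathLength (γ.trans δ) ≤ pathLength γ + pathLength δ := by
  let h : unitInterval := ⟨1 / 2, by norm_num, by norm_num⟩
  have h0 : (0 : unitInterval) ≤ h := h.2.1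
  have h1 : h ≤ 1 := h.2.2
  have key := eVariationOn.Icc_add_Icc (γ.trans δ) h0 h1 (Set.mem_univ h)
  rw [univ_inter_Icc_zero_one] at key
  rw [pathLength, ← key]
  have hmono : ∀ a : ℝ, Monotone fun t : unitInterval =>
      Set.projIcc (0 : ℝ) 1 zero_le_one (2 * t - a) := fun a s t hst =>
    Set.monotone_projIcc _ (by
      have : (s : ℝ) ≤ t := hst
      linarith)
  refine add_le_add ?_ ?_
  · refine le_trans (le_of_eq (eVariationOn.congr fun t ht => ?_))
      (eVariationOn.comp_le_of_monotoneOn γ _ ((hmono 0).monotoneOn _)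
        (Set.mapsTo_univ _ (Set.univ ∩ Set.Icc 0 h)))
    have ht' : (t : ℝ) ≤ 1 / 2 := ht.2.2
    simp only [Path.trans, Path.coe_mk', Function.comp_apply, ContinuousMap.coe_mk, ht', if_true,
      sub_zero]
    rfl
  · refine le_trans (le_of_eq (eVariationOn.congr fun t ht => ?_))
      (eVariationOn.comp_le_of_monotoneOn δ _ ((hmono 1).monotoneOn _)
        (Set.mapsTo_univ _ (Set.univ ∩ Set.Icc h 1)))
    have ht' : 1 / 2 ≤ (t : ℝ) := ht.2.1
    rcases eq_or_lt_of_le ht' with h2 | h2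
    · have h3 : Set.projIcc (0 : ℝ) 1 zero_le_one (2 * t - 1) = 0 := by
        rw [← h2]
        norm_num
      simp only [Function.comp_apply, h3, Path.source]
      rw [Path.trans_apply, dif_pos h2.ge]
      have : ∀ u : unitInterval, (u : ℝ) = 1 → γ u = y := fun u hu => by
        rw [show u = 1 from Subtype.ext hu, γ.target]
      exact this _ (by simp only [← h2]; norm_num)
    · simp only [Path.trans, Path.coe_mk', Function.comp_apply, ContinuousMap.coe_mk,
        not_le.2 h2, if_false]
      rfl

theorem IsLipPath.subpath {l : ℝ} {x y : X} {γ : Path x y} (h : IsLipPath l γ)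
    (a b : unitInterval) : IsLipPath (l * dist a b) (γ.subpath a b) := by
  intro s t
  refine (h _ _).trans (le_of_eq ?_)
  rw [mul_assoc]
  congr 1
  rw [Subtype.dist_eq, Subtype.dist_eq, Subtype.dist_eq, Real.dist_eq, Real.dist_eq, Real.dist_eq,
    ← abs_mul]
  have : ∀ u : unitInterval, ((Set.Icc.convexComb a b u : unitInterval) : ℝ) =
      (1 - u) * a + u * b := fun u => by
    simp [Set.Icc.convexComb]
  rw [this, this, abs_sub_comm]
  congr 1
  ring

/-- A rectifiable path is homotopic to a Lipschitz path of almost the same length. -/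
theorem exists_isLipPath_of_pathLength_lt {x y : X} {β : Path x y} {l : ℝ}
    (h : pathLength β < ENNReal.ofReal l) :
    ∃ γ : Path x y, Path.Homotopic.Quotient.mk β = .mk γ ∧ ∃ l' < l, 0 ≤ l' ∧ IsLipPath l' γ := by
  have hfin : BoundedVariationOn β Set.univ := ne_of_lt (h.trans ENNReal.ofReal_lt_top)
  let W : unitInterval → unitInterval → ENNReal := fun s t =>
    eVariationOn β (Set.univ ∩ Set.Icc s t)
  have hWfin : ∀ s t, W s t ≠ ⊤ := fun s t =>
    ne_of_lt ((eVariationOn.mono β (Set.subset_univ _)).trans_lt (lt_top_iff_ne_top.2 hfin))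
  let V : unitInterval → ℝ := fun t => (W 0 t).toReal
  have hV : ∀ s t, s ≤ t → V t = V s + (W s t).toReal := fun s t hst => by
    rw [← ENNReal.toReal_add (hWfin _ _) (hWfin _ _)]
    exact congrArg ENNReal.toReal
      (eVariationOn.Icc_add_Icc β (unitInterval.nonneg' ) hst (Set.mem_univ s)).symm
  have hVd : ∀ s t, s ≤ t → dist (β s) (β t) ≤ V t - V s := fun s t hst => by
    rw [hV s t hst, add_sub_cancel_left, dist_edist]
    exact ENNReal.toReal_mono (hWfin _ _) (eVariationOn.edist_le β
      ⟨Set.mem_univ _, le_rfl, hst⟩ ⟨Set.mem_univ _, hst, le_rfl⟩)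
  have hVm : ∀ s t, s ≤ t → V s ≤ V t := fun s t hst => by
    linarith [hVd s t hst, dist_nonneg (x := β s) (y := β t)]
  -- A continuous path of bounded variation has small variation over short intervals on both sides
  -- of `t`. Continuity of `V` is what makes `φ` continuous and surjective.
  have hVc : Continuous V := by
    refine continuous_iff_continuousAt.2 fun t => Metric.tendsto_nhds.2 fun ε hε => ?_
    have hl := hfin.tendsto_eVariationOn_Icc_zero_left (x := t)
      β.continuous.continuousAt.continuousWithinAt
    have hr := hfin.tendsto_eVariationOn_Icc_zero_right t
      β.continuous.continuousAt.continuousWithinAt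
    rw [nhdsWithin_univ] at hl hr
    have hε' : (0 : ENNReal) < ENNReal.ofReal ε := ENNReal.ofReal_pos.2 hε
    filter_upwards [hl.eventually_lt_const hε', hr.eventually_lt_const hε'] with s h1 h2
    have key : ∀ a b, W a b < ENNReal.ofReal ε → (W a b).toReal < ε := fun a b hab =>
      (ENNReal.lt_ofReal_iff_toReal_lt (hWfin a b)).1 hab
    rcases le_total s t with hst | hst
    · rw [hV s t hst, dist_comm, Real.dist_eq, add_sub_cancel_left,
        abs_of_nonneg ENNReal.toReal_nonneg]
      exact key _ _ h1
    · rw [hV t s hst, Real.dist_eq, add_sub_cancel_left, abs_of_nonneg ENNReal.toReal_nonneg]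
      exact key _ _ h2
  have hV0 : V 0 = 0 := by
    have : W 0 0 = 0 := eVariationOn.subsingleton β (by simp)
    simp only [V, this, ENNReal.toReal_zero]
  have hV1 : V 1 < l := by
    have : W 0 1 = pathLength β := by
      simp only [W, univ_inter_Icc_zero_one]
      rfl
    simp only [V, this]
    exact (ENNReal.lt_ofReal_iff_toReal_lt hfin).1 h
  have hV1' : 0 ≤ V 1 := ENNReal.toReal_nonneg
  -- Normalized arc length with an added linear term, taken from the slack below `l`. The term keeps
  -- `m` positive even when the path is constant.
  let δ := (l - V 1) / 2
  let m := V 1 + δ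
  have hδ : 0 < δ := by simp only [δ]; linarith
  have hm : 0 < m := by simp only [m]; linarith
  have hml : m < l := by simp only [m, δ]; linarith
  let φ : unitInterval → unitInterval := fun t => ⟨(V t + δ * t) / m, by
    have h1 : 0 ≤ V t := ENNReal.toReal_nonneg
    have h2 := t.2.1
    positivity, by
    have h1 := hVm t 1 unitInterval.le_one'
    have h2 := mul_le_of_le_one_right hδ.le t.2.2
    rw [div_le_one hm]
    simp only [m]
    linarith⟩
  have hφc : Continuous φ := by
    refine Continuous.subtype_mk ?_ _
    fun_prop
  have hφ0 : φ 0 = 0 := Subtype.ext (by simp [φ, hV0])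
  have hφ1 : φ 1 = 1 := Subtype.ext (by simp [φ, m, hm.ne'])
  have hle : ∀ s t, s ≤ t → dist (β s) (β t) ≤ m * dist (φ s) (φ t) := fun s t hst => by
    have h1 : m * dist (φ s) (φ t) = |V s + δ * s - (V t + δ * t)| := by
      rw [Subtype.dist_eq, Real.dist_eq]
      simp only [φ]
      rw [← sub_div, abs_div, abs_of_pos hm, mul_div_cancel₀ _ hm.ne']
    have h2 : δ * (s : ℝ) ≤ δ * t := mul_le_mul_of_nonneg_left hst hδ.le
    rw [h1, abs_sub_comm, abs_of_nonneg (by linarith [hVm s t hst])]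
    linarith [hVd s t hst]
  have hdist : ∀ s t, dist (β s) (β t) ≤ m * dist (φ s) (φ t) := fun s t => by
    rcases le_total s t with hst | hst
    · exact hle s t hst
    · rw [dist_comm, dist_comm (φ s)]
      exact hle t s hst
  have hsurj : Function.Surjective φ := fun u => by
    have := intermediate_value_univ (0 : unitInterval) 1 hφc
    rw [hφ0, hφ1] at this
    exact this ⟨u.2.1, u.2.2⟩
  -- The path `β` is constant on the fibres of `φ`, so it factors through `φ` as `β ∘ ψ` for any
  -- section `ψ`, and the factor is `m`-Lipschitz.
  choose ψ hψ using hsurj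
  have heq : ∀ s t, φ s = φ t → β s = β t := fun s t hst =>
    dist_le_zero.1 (by simpa [hst] using hdist s t)
  have hlip : ∀ s t, dist (β (ψ s)) (β (ψ t)) ≤ m * dist s t := fun s t => by
    simpa only [hψ] using hdist (ψ s) (ψ t)
  let γ : Path x y :=
    { toFun := fun t => β (ψ t)
      continuous_toFun :=
        (LipschitzWith.of_dist_le_mul (K := ⟨m, hm.le⟩) hlip).continuous
      source' := (heq _ _ ((hψ 0).trans hφ0.symm)).trans β.source
      target' := (heq _ _ ((hψ 1).trans hφ1.symm)).trans β.target }
  refine ⟨γ, ?_, m, hml, hm.le, hlip⟩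
  have hγ : γ.reparam φ hφc hφ0 hφ1 = β := by
    ext t
    exact heq _ _ (hψ _)
  refine (Path.Homotopic.Quotient.eq.2 ?_).symm
  have := Path.Homotopy.reparam γ φ hφc hφ0 hφ1
  rw [hγ] at this
  exact ⟨this⟩

end Length

/-! ### Holonomy modulo a normal subgroup of the fundamental group -/

section Holonomy

variable {X : Type*} [MetricSpace X] {x₀ : X}

/-- The class of a path modulo a normal subgroup `N` of `π₁(X, x₀)`, after joining its end points
to the base point by the paths `p`. -/
def hol (p : ∀ y, Path x₀ y) (N : Subgroup (FundamentalGroup X x₀)) {y z : X}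
    (q : Quotient y z) : FundamentalGroup X x₀ ⧸ N :=
  QuotientGroup.mk (FundamentalGroup.fromPath
    ((Path.Homotopic.Quotient.mk (p z)).trans
      (q.symm.trans (Path.Homotopic.Quotient.mk (p y)).symm)))

variable (p : ∀ y, Path x₀ y) (N : Subgroup (FundamentalGroup X x₀)) [N.Normal]

theorem hol_trans {x y z : X} (q : Quotient x y) (q' : Quotient y z) :
    hol p N (q.trans q') = hol p N q * hol p N q' := by
  rw [hol, hol, hol, ← QuotientGroup.mk_mul]
  congr 1
  -- A product in `FundamentalGroup` is the composite of paths in the opposite order. The reversal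
  -- of `q` inside `hol` compensates for this.
  change _ = Quotient.trans _ _
  simp only [Quotient.symm_trans_rev, Quotient.trans_assoc, Quotient.symm_trans_cancel]

theorem hol_refl (y : X) : hol p N (Quotient.refl y) = 1 := by
  have h := hol_trans p N (Quotient.refl y) (Quotient.refl y)
  rw [Quotient.refl_trans] at h
  exact left_eq_mul.1 h

theorem hol_symm {y z : X} (q : Quotient y z) : hol p N q.symm = (hol p N q)⁻¹ := by
  rw [eq_inv_iff_mul_eq_one, ← hol_trans, Quotient.symm_trans, hol_refl]

omit [N.Normal] in
theorem hol_cast {y z y' z' : X} (γ : Path y z) (hy : y' = y) (hz : z' = z) :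
    hol p N (.mk (γ.cast hy hz)) = hol p N (.mk γ) := by
  subst hy hz
  rfl

theorem hol_subpath_trans {y z : X} (γ : Path y z) (a b c : unitInterval) :
    hol p N (.mk (γ.subpath a b)) * hol p N (.mk (γ.subpath b c)) =
      hol p N (.mk (γ.subpath a c)) := by
  have hc : Path.Homotopic _ _ := ⟨Path.Homotopy.subpathTransSubpath γ a b c⟩
  rw [← hol_trans, ← Path.Homotopic.Quotient.mk_trans, Path.Homotopic.Quotient.eq.2 hc]

omit [N.Normal] in
theorem hol_subpath_zero_one {y z : X} (γ : Path y z) :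
    hol p N (.mk (γ.subpath 0 1)) = hol p N (.mk γ) := by
  rw [Path.subpath_zero_one, hol_cast]

theorem lassoClass_eq {y : X} (α : Path x₀ y) (β : Path y y) :
    lassoClass α β = (Path.Homotopic.Quotient.mk α).trans
      ((Path.Homotopic.Quotient.mk β).trans (Path.Homotopic.Quotient.mk α).symm) := by
  rw [← Quotient.trans_assoc]
  rfl

/-- A lasso lies in `N` exactly if its loop has trivial holonomy. -/
theorem lassoClass_mem_iff {y : X} (α : Path x₀ y) (β : Path y y) :
    lassoClass α β ∈ N ↔ hol p N (.mk β) = 1 := by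
  -- Conjugation by `g` exchanges the tail `α` for the standard tail `p y`; a normal subgroup does
  -- not notice.
  let g : FundamentalGroup X x₀ := (Path.Homotopic.Quotient.mk (p y)).trans
    (Path.Homotopic.Quotient.mk α).symm
  have key : FundamentalGroup.fromPath ((Path.Homotopic.Quotient.mk (p y)).trans
      ((Path.Homotopic.Quotient.mk β).symm.trans (Path.Homotopic.Quotient.mk (p y)).symm)) =
      g⁻¹ * (lassoClass α β)⁻¹ * g := by
    rw [lassoClass_eq]
    rw [FundamentalGroup.mul_def, FundamentalGroup.mul_def, FundamentalGroup.inv_def,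
      FundamentalGroup.inv_def]
    simp only [g, Quotient.symm_trans_rev, Quotient.symm_symm, Quotient.trans_assoc,
      Quotient.symm_trans_cancel]
  rw [hol, key, QuotientGroup.eq_one_iff]
  constructor
  · intro h
    exact Subgroup.Normal.conj_mem' ‹_› _ (N.inv_mem h) g
  · intro h
    have := Subgroup.Normal.conj_mem ‹N.Normal› _ h g
    rw [mul_assoc, mul_assoc, mul_inv_cancel, mul_one, mul_inv_cancel_left] at this
    exact inv_mem_iff.1 this

/-- The set of lassos whose loop satisfies a condition. -/
def lassoSet (x₀ : X) (C : ∀ y : X, Path y y → Prop) : Set (FundamentalGroup X x₀) :=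
  {g | ∃ (y : X) (α : Path x₀ y) (β : Path y y), C y β ∧ g = lassoClass α β}

variable {C : ∀ y : X, Path y y → Prop}

/-- Conjugating a lasso only changes its tail, and the condition `C` concerns only the loop. -/
theorem normal_closure_lassoSet (x₀ : X) (C : ∀ y : X, Path y y → Prop) :
    (Subgroup.closure (lassoSet x₀ C)).Normal := by
  have hconj : ∀ g : FundamentalGroup X x₀, ∀ h ∈ lassoSet x₀ C, g * h * g⁻¹ ∈ lassoSet x₀ C := by
    rintro g _ ⟨y, α, β, hβ, rfl⟩
    obtain ⟨γ, hγ⟩ := Path.Homotopic.Quotient.mk_surjective g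
    refine ⟨y, γ.symm.trans α, β, hβ, ?_⟩
    rw [lassoClass_eq, lassoClass_eq, ← hγ]
    rw [FundamentalGroup.mul_def, FundamentalGroup.mul_def, FundamentalGroup.inv_def]
    simp only [Path.Homotopic.Quotient.mk_trans, Path.Homotopic.Quotient.mk_symm,
      Quotient.symm_trans_rev, Quotient.symm_symm, Quotient.trans_assoc]
  refine ⟨fun n hn g => ?_⟩
  induction hn using Subgroup.closure_induction with
  | mem h hh => exact Subgroup.subset_closure (hconj g h hh)
  | one =>
    rw [mul_one, mul_inv_cancel]
    exact one_mem _
  | mul a b _ _ ha hb =>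
    have := mul_mem ha hb
    rwa [show g * a * g⁻¹ * (g * b * g⁻¹) = g * (a * b) * g⁻¹ by group] at this
  | inv a _ ha =>
    have := inv_mem ha
    rwa [show (g * a * g⁻¹)⁻¹ = g * a⁻¹ * g⁻¹ by group] at this

/-- Since `N` is normal the tails are irrelevant, and containment becomes a condition on
free-standing loops. All comparisons of subgroups below pass through this form. -/
theorem closure_lassoSet_le_iff :
    Subgroup.closure (lassoSet x₀ C) ≤ N ↔
      ∀ (y : X) (β : Path y y), C y β → hol p N (.mk β) = 1 := by
  rw [Subgroup.closure_le]
  constructor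
  · intro h y β hβ
    exact (lassoClass_mem_iff p N (p y) β).1 (h ⟨y, p y, β, hβ, rfl⟩)
  · rintro h _ ⟨y, α, β, hβ, rfl⟩
    exact (lassoClass_mem_iff p N α β).2 (h y β hβ)

end Holonomy

/-! ### The subgroups generated by short lassos and by lassos in small balls -/

section Subgroups

variable {X : Type*} [MetricSpace X] {x₀ : X}

theorem lengthSubgroup_eq (x₀ : X) (r : ℝ) : lengthSubgroup x₀ r =
    Subgroup.closure (lassoSet x₀ fun _ β => pathLength β < ENNReal.ofReal r) :=
  rfl

theorem spanierSubgroup_eq (x₀ : X) (r : ℝ) : spanierSubgroup x₀ r =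
    Subgroup.closure (lassoSet x₀ fun _ β =>
      ∃ (w : X) (d : ℝ), d < r ∧ Set.range β ⊆ Metric.closedBall w d) := by
  rw [spanierSubgroup]
  congr 1
  ext g
  constructor
  · rintro ⟨y, α, β, w, d, hd, hβ, rfl⟩
    exact ⟨y, α, β, ⟨w, d, hd, hβ⟩, rfl⟩
  · rintro ⟨y, α, β, ⟨w, d, hd, hβ⟩, rfl⟩
    exact ⟨y, α, β, w, d, hd, hβ, rfl⟩

instance (x₀ : X) (r : ℝ) : (lengthSubgroup x₀ r).Normal :=
  normal_closure_lassoSet _ _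

instance (x₀ : X) (r : ℝ) : (spanierSubgroup x₀ r).Normal := by
  rw [spanierSubgroup_eq]
  exact normal_closure_lassoSet _ _

instance (x₀ : X) (l : ℝ) : (Subgroup.closure (geodesicLassoClasses x₀ l)).Normal :=
  normal_closure_lassoSet _ _

theorem lengthSubgroup_mono (x₀ : X) {r s : ℝ} (h : r ≤ s) :
    lengthSubgroup x₀ r ≤ lengthSubgroup x₀ s := by
  refine Subgroup.closure_mono ?_
  rintro _ ⟨y, α, β, hβ, rfl⟩
  exact ⟨y, α, β, hβ.trans_le (ENNReal.ofReal_le_ofReal h), rfl⟩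

theorem spanierSubgroup_mono (x₀ : X) {r s : ℝ} (h : r ≤ s) :
    spanierSubgroup x₀ r ≤ spanierSubgroup x₀ s := by
  refine Subgroup.closure_mono ?_
  rintro _ ⟨y, α, β, w, d, hd, hβ, rfl⟩
  exact ⟨y, α, β, w, d, hd.trans_le h, hβ, rfl⟩

/-- A loop of length less than `l` lies in a closed ball of radius less than `l / 2`. -/
theorem lengthSubgroup_le_spanierSubgroup (x₀ : X) (l : ℝ) :
    lengthSubgroup x₀ l ≤ spanierSubgroup x₀ (l / 2) := by
  refine Subgroup.closure_mono ?_
  rintro _ ⟨y, α, β, hβ, rfl⟩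
  have hfin : pathLength β ≠ ⊤ := ne_of_lt (hβ.trans ENNReal.ofReal_lt_top)
  have hl : (pathLength β).toReal < l := (ENNReal.lt_ofReal_iff_toReal_lt hfin).1 hβ
  -- The ball is centred at the base point of `β`: going out to `β t` and back costs at least twice
  -- the distance.
  refine ⟨y, α, β, y, (pathLength β).toReal / 2, by linarith, ?_, rfl⟩
  rintro _ ⟨t, rfl⟩
  have h1 : edist (β 0) (β t) ≤ eVariationOn β (Set.univ ∩ Set.Icc 0 t) :=
    eVariationOn.edist_le β ⟨trivial, le_rfl, unitInterval.nonneg'⟩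
      ⟨trivial, unitInterval.nonneg', le_rfl⟩
  have h2 : edist (β t) (β 1) ≤ eVariationOn β (Set.univ ∩ Set.Icc t 1) :=
    eVariationOn.edist_le β ⟨trivial, le_rfl, unitInterval.le_one'⟩
      ⟨trivial, unitInterval.le_one', le_rfl⟩
  have h3 := add_le_add h1 h2
  rw [eVariationOn.Icc_add_Icc β unitInterval.nonneg' unitInterval.le_one' (Set.mem_univ t),
    univ_inter_Icc_zero_one, β.source, β.target, edist_comm y] at h3
  have h4 := ENNReal.toReal_mono hfin h3
  rw [ENNReal.toReal_add (edist_ne_top _ _) (edist_ne_top _ _), ← dist_edist] at h4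
  rw [Metric.mem_closedBall]
  linarith

/-- Each element of a Spanier-type subgroup belongs to one of smaller scale. -/
theorem exists_mem_spanierSubgroup_of_mem {r : ℝ} {g : FundamentalGroup X x₀}
    (hg : g ∈ spanierSubgroup x₀ r) : ∃ s < r, g ∈ spanierSubgroup x₀ s := by
  induction hg using Subgroup.closure_induction with
  | mem g hg =>
    obtain ⟨y, α, β, w, d, hd, hβ, rfl⟩ := hg
    obtain ⟨s, hs, hsr⟩ := exists_between hd
    exact ⟨s, hsr, Subgroup.subset_closure ⟨y, α, β, w, d, hs, hβ, rfl⟩⟩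
  | one => exact ⟨r - 1, by linarith, one_mem _⟩
  | mul a b _ _ ha hb =>
    obtain ⟨s, hs, ha⟩ := ha
    obtain ⟨t, ht, hb⟩ := hb
    exact ⟨max s t, max_lt hs ht, mul_mem (spanierSubgroup_mono x₀ (le_max_left _ _) ha)
      (spanierSubgroup_mono x₀ (le_max_right _ _) hb)⟩
  | inv a _ ha =>
    obtain ⟨s, hs, ha⟩ := ha
    exact ⟨s, hs, inv_mem ha⟩

variable (p : ∀ y, Path x₀ y) (N : Subgroup (FundamentalGroup X x₀)) [N.Normal]

theorem lengthSubgroup_le_iff {l : ℝ} : lengthSubgroup x₀ l ≤ N ↔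
    ∀ (y : X) (β : Path y y), pathLength β < ENNReal.ofReal l → hol p N (.mk β) = 1 := by
  rw [lengthSubgroup_eq, closure_lassoSet_le_iff p N]

theorem spanierSubgroup_le_iff {r : ℝ} : spanierSubgroup x₀ r ≤ N ↔
    ∀ (y : X) (β : Path y y) (w : X) (d : ℝ), d < r → Set.range β ⊆ Metric.closedBall w d →
      hol p N (.mk β) = 1 := by
  rw [spanierSubgroup_eq, closure_lassoSet_le_iff p N]
  exact ⟨fun h y β w d hd hβ => h y β ⟨w, d, hd, hβ⟩, fun h y β ⟨w, d, hd, hβ⟩ =>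
    h y β w d hd hβ⟩

/-! ### Comparison of paths and geodesics modulo short lassos and small balls -/

variable {N}

/-- Paths with common end points and small total length have the same holonomy. -/
theorem hol_eq_of_isLipPath {l : ℝ} (hN : lengthSubgroup x₀ l ≤ N) {y z : X} {γ δ : Path y z}
    {a b : ℝ} (ha : 0 ≤ a) (hb : 0 ≤ b) (hγ : IsLipPath a γ) (hδ : IsLipPath b δ)
    (hab : a + b < l) : hol p N (.mk γ) = hol p N (.mk δ) := by
  have hlen : pathLength (γ.trans δ.symm) < ENNReal.ofReal l := by
    refine (pathLength_trans_le _ _).trans_lt ?_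
    refine (add_le_add (pathLength_le_of_isLipPath hγ) ((pathLength_symm_le _).trans
      (pathLength_le_of_isLipPath hδ))).trans_lt ?_
    rw [← ENNReal.ofReal_add ha hb]
    exact (ENNReal.ofReal_lt_ofReal_iff (by linarith)).2 hab
  have := (lengthSubgroup_le_iff p N).1 hN y _ hlen
  rw [Path.Homotopic.Quotient.mk_trans, Path.Homotopic.Quotient.mk_symm, hol_trans, hol_symm] at this
  exact mul_inv_eq_one.1 this

/-- Paths with common end points inside a small ball have the same holonomy. -/
theorem hol_eq_of_closedBall {ε : ℝ} (hN : spanierSubgroup x₀ ε ≤ N) {y z : X} {γ δ : Path y z}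
    {w : X} {d : ℝ} (hd : d < ε) (hγ : ∀ t, dist (γ t) w ≤ d) (hδ : ∀ t, dist (δ t) w ≤ d) :
    hol p N (.mk γ) = hol p N (.mk δ) := by
  have h : Set.range (γ.trans δ.symm) ⊆ Metric.closedBall w d := by
    rw [Path.trans_range, Path.symm_range]
    rintro _ (⟨t, rfl⟩ | ⟨t, rfl⟩)
    · exact hγ t
    · exact hδ t
  have := (spanierSubgroup_le_iff p N).1 hN y _ w d hd h
  rw [Path.Homotopic.Quotient.mk_trans, Path.Homotopic.Quotient.mk_symm, hol_trans, hol_symm] at this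
  exact mul_inv_eq_one.1 this

/-- The holonomy of a chosen geodesic. -/
def geoHol (hX : IsGeodesicSpace X) (p : ∀ y, Path x₀ y) (N : Subgroup (FundamentalGroup X x₀))
    (y z : X) : FundamentalGroup X x₀ ⧸ N :=
  hol p N (.mk (exists_geodesic_path hX y z).choose)

variable (hX : IsGeodesicSpace X)

theorem hol_eq_geoHol_of_isLipPath {l : ℝ} (hN : lengthSubgroup x₀ l ≤ N) {y z : X} {γ : Path y z}
    {a : ℝ} (ha : 0 ≤ a) (hγ : IsLipPath a γ) (hal : a + dist y z < l) :
    hol p N (.mk γ) = geoHol hX p N y z :=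
  hol_eq_of_isLipPath p hN ha dist_nonneg hγ (exists_geodesic_path hX y z).choose_spec hal

/-- The geodesic triangle is a loop of length less than `l`. For the simplices of `Rips(X, r)` this
applies with `l = 3 * r`, which is the origin of the factor three. -/
theorem geoHol_trans {l : ℝ} (hN : lengthSubgroup x₀ l ≤ N) {x y z : X}
    (h : dist x y + dist y z + dist x z < l) :
    geoHol hX p N x y * geoHol hX p N y z = geoHol hX p N x z := by
  let γ := (exists_geodesic_path hX x y).choose
  let δ := (exists_geodesic_path hX y z).choose
  let ζ := (exists_geodesic_path hX x z).choose
  have hγ := pathLength_le_of_isLipPath (exists_geodesic_path hX x y).choose_spec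
  have hδ := pathLength_le_of_isLipPath (exists_geodesic_path hX y z).choose_spec
  have hζ := pathLength_le_of_isLipPath (exists_geodesic_path hX x z).choose_spec
  have hlen : pathLength ((γ.trans δ).trans ζ.symm) < ENNReal.ofReal l := by
    refine (pathLength_trans_le _ _).trans_lt ((add_le_add ((pathLength_trans_le _ _).trans
      (add_le_add hγ hδ)) ((pathLength_symm_le _).trans hζ)).trans_lt ?_)
    rw [← ENNReal.ofReal_add dist_nonneg dist_nonneg, ← ENNReal.ofReal_add (by positivity)
      dist_nonneg]
    exact (ENNReal.ofReal_lt_ofReal_iff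
      (lt_of_le_of_lt (by positivity) h)).2 h
  have := (lengthSubgroup_le_iff p N).1 hN x _ hlen
  rw [Path.Homotopic.Quotient.mk_trans, Path.Homotopic.Quotient.mk_trans,
    Path.Homotopic.Quotient.mk_symm, hol_trans, hol_trans, hol_symm] at this
  exact mul_inv_eq_one.1 this

theorem geoHol_self {l : ℝ} (hl : 0 < l) (hN : lengthSubgroup x₀ l ≤ N) (x : X) :
    geoHol hX p N x x = 1 := by
  have := geoHol_trans p hX hN (x := x) (y := x) (z := x) (by simpa using hl)
  exact mul_eq_left.1 this

/-- Short pieces of any path have the same holonomy as geodesics, modulo small lassos. -/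
theorem hol_eq_geoHol_of_small {ε : ℝ} (hN : spanierSubgroup x₀ ε ≤ N) {y z : X} {γ : Path y z}
    (h : ∀ t, dist (γ t) y < ε / 2) : hol p N (.mk γ) = geoHol hX p N y z := by
  have hyz : dist y z < ε / 2 := by
    rw [dist_comm]
    simpa using h 1
  refine hol_eq_of_closedBall p hN (w := y) (d := ε / 2) (by linarith [dist_nonneg (x := y) (y := z)])
    (fun t => (h t).le) fun t => ?_
  rw [dist_comm]
  exact ((exists_geodesic_path hX y z).choose_spec.dist_left_le dist_nonneg t).trans hyz.le

/-- Modulo short lassos, loops in a ball decompose into small loops. -/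
theorem spanierSubgroup_le_of_lengthSubgroup_le (hX : IsGeodesicSpace X) {l ε : ℝ} (hε : 0 < ε)
    (hl : lengthSubgroup x₀ l ≤ N) (hs : spanierSubgroup x₀ ε ≤ N) :
    spanierSubgroup x₀ (l / 2) ≤ N := by
  have p : ∀ y, Path x₀ y := fun y => (exists_geodesic_path hX x₀ y).choose
  refine (spanierSubgroup_le_iff p N).2 fun y β w d hd hβ => ?_
  have hb : ∀ t, dist (β t) w ≤ d := fun t => hβ ⟨t, rfl⟩
  -- The holonomy of a piece is compared with the detour through the centre `w`; detours telescope
  -- under composition.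
  have key := path_chain (P := fun a b q => dist a w ≤ d ∧ dist b w ≤ d ∧
    hol p N q = geoHol hX p N a w * geoHol hX p N w b) ?_ β ?_
  · obtain ⟨h1, -, h⟩ := key
    have h0 : 0 ≤ d := dist_nonneg.trans h1
    rw [h, geoHol_trans p hX hl, geoHol_self p hX (by linarith) hl]
    rw [dist_comm w y, dist_self]
    linarith
  · rintro a b c q q' ⟨ha, hb, hq⟩ ⟨-, hc, hq'⟩
    refine ⟨ha, hc, ?_⟩
    have h0 : 0 ≤ d := dist_nonneg.trans ha
    rw [hol_trans, hq, hq', mul_assoc, ← mul_assoc (geoHol hX p N w b), geoHol_trans p hX hl,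
      geoHol_self p hX (by linarith) hl, one_mul]
    rw [dist_comm w b, dist_self]
    linarith
  · intro t
    -- The first bound lets geodesics replace the pieces; the second keeps the perimeter of the
    -- triangle on `w` and the two end points below `2 * d + (l - 2 * d) = l`.
    obtain ⟨U, hU, h⟩ := exists_nhds_subpath_dist β t
      (lt_min (half_pos hε) (by linarith : 0 < l - 2 * d))
    refine ⟨U, hU, fun a ha b hbU _ => ⟨hb a, hb b, ?_⟩⟩
    have hab : dist (β a) (β b) < l - 2 * d := by
      rw [dist_comm]
      simpa using (h a ha b hbU 1).trans_le (min_le_right _ _)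
    rw [hol_eq_geoHol_of_small p hX hs fun s => (h a ha b hbU s).trans_le (min_le_left _ _),
      geoHol_trans p hX hl]
    rw [dist_comm w]
    linarith [hb a, hb b]

/-- A loop in a ball of radius below `l / 2` is cut into thin triangles from the centre, up to loops
in `ε`-balls. So balls at a large scale contribute only short loops beyond those at an arbitrarily
small scale. -/
theorem spanierSubgroup_eq_sup (hX : IsGeodesicSpace X) (x₀ : X) {l ε : ℝ} (hε : 0 < ε)
    (hεl : ε ≤ l / 2) :
    spanierSubgroup x₀ (l / 2) = lengthSubgroup x₀ l ⊔ spanierSubgroup x₀ ε :=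
  le_antisymm (spanierSubgroup_le_of_lengthSubgroup_le hX hε le_sup_left le_sup_right)
    (sup_le (lengthSubgroup_le_spanierSubgroup x₀ l) (spanierSubgroup_mono x₀ hεl))

/-- Uniformly close loops have trivial holonomy simultaneously. -/
theorem hol_eq_one_of_close (hX : IsGeodesicSpace X) {ε : ℝ}
    (hN : spanierSubgroup x₀ ε ≤ N) {y y' : X} {β : Path y y} {β' : Path y' y'}
    (h : ∀ t, dist (β t) (β' t) < ε / 4) (hβ : hol p N (.mk β) = 1) :
    hol p N (.mk β') = 1 := by
  have hε : 0 < ε := by linarith [h 0, dist_nonneg (x := β 0) (y := β' 0)]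
  -- Chopping the product path in `X × X` subdivides both loops simultaneously. The predicate says
  -- that a ladder with geodesic rungs commutes.
  have key := path_chain (P := fun a b q =>
    hol p N (q.map ContinuousMap.fst) * geoHol hX p N b.1 b.2 =
      geoHol hX p N a.1 a.2 * hol p N (q.map ContinuousMap.snd)) ?_ (β.prod β') ?_
  · have h1 : hol p N (.mk β) * geoHol hX p N y y' = geoHol hX p N y y' * hol p N (.mk β') := key
    rw [hβ, one_mul] at h1
    exact left_eq_mul.1 h1
  · intro a b c q q' hq hq'
    rw [Quotient.map_trans, Quotient.map_trans, hol_trans, hol_trans, mul_assoc, hq', ← mul_assoc,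
      hq, mul_assoc]
  · intro t
    obtain ⟨U, hU, hU'⟩ := exists_nhds_subpath_dist (β.prod β') t (by positivity : 0 < ε / 4)
    refine ⟨U, hU, fun a ha b hb _ => ?_⟩
    have h1 : ∀ s, dist (β.subpath a b s) (β a) < ε / 4 := fun s =>
      (le_max_left _ _).trans_lt (hU' a ha b hb s)
    have h2 : ∀ s, dist (β'.subpath a b s) (β' a) < ε / 4 := fun s =>
      (le_max_right _ _).trans_lt (hU' a ha b hb s)
    have hb1 : dist (β b) (β a) < ε / 4 := by simpa using h1 1
    have hg : ∀ c s, dist ((exists_geodesic_path hX (β c) (β' c)).choose s) (β c) ≤ ε / 4 :=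
      fun c s => by
        rw [dist_comm]
        exact ((exists_geodesic_path hX (β c) (β' c)).choose_spec.dist_left_le dist_nonneg s).trans
          (h c).le
    -- Both ways around a single square of the ladder stay in the ball of radius `ε / 2` around `β
    -- a`.
    have key : hol p N (.mk ((β.subpath a b).trans (exists_geodesic_path hX (β b) (β' b)).choose)) =
        hol p N (.mk ((exists_geodesic_path hX (β a) (β' a)).choose.trans (β'.subpath a b))) := by
      refine hol_eq_of_closedBall p hN (w := β a) (d := ε / 2) (by linarith) (fun s => ?_) fun s => ?_
      · rw [Path.trans_apply]
        split_ifs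
        · linarith [h1 ⟨2 * s, by constructor <;> linarith [s.2.1]⟩]
        · refine (dist_triangle _ (β b) _).trans ?_
          linarith [hg b ⟨2 * s - 1, by constructor <;> linarith [s.2.2]⟩]
      · rw [Path.trans_apply]
        split_ifs
        · linarith [hg a ⟨2 * s, by constructor <;> linarith [s.2.1]⟩]
        · refine (dist_triangle _ (β' a) _).trans ?_
          rw [dist_comm (β' a)]
          linarith [h2 ⟨2 * s - 1, by constructor <;> linarith [s.2.2]⟩, h a]
    rw [Path.Homotopic.Quotient.mk_trans, Path.Homotopic.Quotient.mk_trans, hol_trans,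
      hol_trans] at key
    exact key

end Subgroups

/-! ### Loops that are not geodesic circles decompose into shorter loops -/

section Split

variable {X : Type*} [MetricSpace X] {x₀ : X}

theorem norm_coe_addCircle {l z : ℝ} (hl : 0 < l) (h0 : 0 ≤ z) (h1 : z ≤ l) :
    ‖(z : AddCircle l)‖ = min z (l - z) := by
  rcases le_total z (l / 2) with h | h
  · rw [(AddCircle.norm_coe_eq_abs_iff l hl.ne').2, abs_of_nonneg h0, min_eq_left (by linarith)]
    rwa [abs_of_nonneg h0, abs_of_pos hl]
  · have : (z : AddCircle l) = ((z - l : ℝ) : AddCircle l) := by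
      rw [AddCircle.coe_sub, AddCircle.coe_period, sub_zero]
    rw [this, (AddCircle.norm_coe_eq_abs_iff l hl.ne').2, abs_of_nonpos (by linarith),
      min_eq_right (by linarith)]
    · ring
    · rw [abs_of_nonpos (by linarith), abs_of_pos hl]
      linarith

/-- A Lipschitz loop realizing the arc-length distances of a circle traverses a geodesic circle. -/
theorem isGeodesicCircleLoop_of_dist_eq {l : ℝ} (hl : 0 < l) {y : X} {β : Path y y}
    (h : ∀ s t : unitInterval, s ≤ t →
      dist (β s) (β t) = min (l * (t - s)) (l * (1 - (t - s)))) :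
    IsGeodesicCircleLoop l β := by
  have : Fact (0 < l) := ⟨hl⟩
  let b : ℝ → X := fun x => β (Set.projIcc 0 1 zero_le_one (x / l))
  let f : AddCircle l → X := AddCircle.liftIco l 0 b
  have hf : ∀ x ∈ Set.Ico 0 l, f x = b x := fun x hx => AddCircle.liftIco_zero_coe_apply hx
  have hproj : ∀ x ∈ Set.Ico 0 l, ((Set.projIcc (0 : ℝ) 1 zero_le_one (x / l) : unitInterval) : ℝ) =
      x / l := fun x hx => by
    rw [Set.projIcc_of_mem _ ⟨div_nonneg hx.1 hl.le, (div_le_one hl).2 hx.2.le⟩]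
  have hle : ∀ x ∈ Set.Ico 0 l, ∀ z ∈ Set.Ico 0 l, x ≤ z →
      dist (f x) (f z) = dist (x : AddCircle l) z := by
    intro x hx z hz hxz
    rw [hf x hx, hf z hz, h _ _ (Set.monotone_projIcc _ (by gcongr)), hproj x hx, hproj z hz,
      dist_comm, dist_eq_norm, ← AddCircle.coe_sub, norm_coe_addCircle hl (by linarith)
      (by linarith [hx.1, hz.2])]
    congr 1 <;> field_simp
  refine ⟨f, ⟨hl, Isometry.of_dist_eq fun a c => ?_⟩, fun t => ?_⟩
  · have hex : ∀ a : AddCircle l, ∃ x ∈ Set.Ico 0 l, (x : AddCircle l) = a := fun a =>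
      ⟨AddCircle.equivIco l 0 a, by simpa using (AddCircle.equivIco l 0 a).2,
        AddCircle.coe_equivIco⟩
    obtain ⟨x, hx, rfl⟩ := hex a
    obtain ⟨z, hz, rfl⟩ := hex c
    rcases le_total x z with hxz | hxz
    · exact hle x hx z hz hxz
    · rw [dist_comm, hle z hz x hx hxz, dist_comm]
  -- The parameter `1` falls outside the fundamental domain `[0, l)` and is wrapped to `0`.
  · rcases eq_or_lt_of_le t.2.2 with ht | ht
    · rw [show t = 1 from Subtype.ext ht, β.target]
      have : ((l * ((1 : unitInterval) : ℝ) : ℝ) : AddCircle l) = ((0 : ℝ) : AddCircle l) := by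
        simp [AddCircle.coe_period]
      rw [this, hf 0 ⟨le_rfl, hl⟩]
      simp [b]
    · rw [hf _ ⟨mul_nonneg hl.le t.2.1, mul_lt_of_lt_one_right hl ht⟩]
      simp only [b]
      rw [mul_div_cancel_left₀ _ hl.ne', Set.projIcc_val]

variable (p : ∀ y, Path x₀ y) {N : Subgroup (FundamentalGroup X x₀)} [N.Normal]

/-- An `l`-Lipschitz loop is a geodesic circle of length `l` or a product of shorter lassos. -/
theorem hol_eq_one_or_isGeodesicCircleLoop (hX : IsGeodesicSpace X) {l : ℝ} (hl : 0 < l)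
    (hN : lengthSubgroup x₀ l ≤ N) {y : X} {β : Path y y} (hβ : IsLipPath l β) :
    hol p N (.mk β) = 1 ∨ IsGeodesicCircleLoop l β := by
  have hd : ∀ s t : unitInterval, s ≤ t → dist s t = (t : ℝ) - s := fun s t hst => by
    rw [Subtype.dist_eq, dist_comm, Real.dist_eq,
      abs_of_nonneg (sub_nonneg.2 (show (s : ℝ) ≤ t from hst))]
  have h0 : ∀ s : unitInterval, dist 0 s = s := fun s => by
    rw [hd 0 s unitInterval.nonneg']
    simp
  have h1 : ∀ s : unitInterval, dist s 1 = 1 - s := fun s => by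
    rw [hd s 1 unitInterval.le_one']
    simp
  have hub1 : ∀ s t, s ≤ t → dist (β s) (β t) ≤ l * (t - s) := fun s t hst => by
    rw [← hd s t hst]
    exact hβ s t
  have hub2 : ∀ s t, s ≤ t → dist (β s) (β t) ≤ l * (1 - (t - s)) := fun s t hst => by
    have h2 := hβ 0 s
    have h3 := hβ t 1
    rw [h0] at h2
    rw [h1] at h3
    rw [β.source] at h2
    rw [β.target] at h3
    have := dist_triangle_left (β s) (β t) y
    rw [dist_comm y (β t)] at this
    linarith
  -- A chord shorter than both arcs between its ends cuts the loop into two loops of length less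
  -- than `l`. Without such a chord, every distance equals the shorter arc.
  by_cases hs : ∃ s t : unitInterval, s ≤ t ∧ dist (β s) (β t) < l * (t - s) ∧
      dist (β s) (β t) < l * (1 - (t - s))
  · left
    obtain ⟨s, t, hst, hs1, hs2⟩ := hs
    have hB : hol p N (.mk (β.subpath s t)) = geoHol hX p N (β s) (β t) := by
      refine hol_eq_geoHol_of_isLipPath p hX hN (mul_nonneg hl.le dist_nonneg) (hβ.subpath s t) ?_
      rw [hd s t hst]
      linarith
    let g := (exists_geodesic_path hX (β s) (β t)).choose
    have h01 : β 0 = β 1 := β.source.trans β.target.symm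
    let C : Path (β t) (β 0) := (β.subpath t 1).cast rfl h01
    have hlen : pathLength (((β.subpath 0 s).trans g).trans C) < ENNReal.ofReal l := by
      refine (pathLength_trans_le _ _).trans_lt ((add_le_add ((pathLength_trans_le _ _).trans
        (add_le_add (pathLength_le_of_isLipPath (hβ.subpath 0 s)) (pathLength_le_of_isLipPath
        (exists_geodesic_path hX (β s) (β t)).choose_spec))) (pathLength_le_of_isLipPath (γ := C)
        (hβ.subpath t 1))).trans_lt ?_)
      rw [← ENNReal.ofReal_add (by positivity) dist_nonneg, ← ENNReal.ofReal_add (by positivity)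
        (by positivity), ENNReal.ofReal_lt_ofReal_iff hl, h0, h1]
      linarith
    have key := (lengthSubgroup_le_iff p N).1 hN _ _ hlen
    rw [Path.Homotopic.Quotient.mk_trans, Path.Homotopic.Quotient.mk_trans, hol_trans, hol_trans,
      hol_cast] at key
    rw [← hol_subpath_zero_one, ← hol_subpath_trans p N β 0 t 1, ← hol_subpath_trans p N β 0 s t, hB]
    exact key
  · right
    push Not at hs
    refine isGeodesicCircleLoop_of_dist_eq hl fun s t hst => le_antisymm
      (le_min (hub1 s t hst) (hub2 s t hst)) ?_
    by_cases h : dist (β s) (β t) < l * (t - s)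
    · exact (min_le_right _ _).trans (hs s t hst h)
    · exact (min_le_left _ _).trans (not_lt.1 h)

end Split

/-! ### The fundamental group of the Rips complex -/

section Kernel

variable {X : Type*} [MetricSpace X] {x₀ : X} {r : ℝ} {hr : 0 < r}

theorem someVertex_vertex (x : X) : someVertex (Realization.vertex (rips X r hr) x) = x := by
  have := someVertex_mem (Realization.vertex (rips X r hr) x)
  simpa using this

variable (p : ∀ y, Path x₀ y) (N : Subgroup (FundamentalGroup X x₀)) [N.Normal]

/-- The short pieces of `γ` have the holonomy of geodesics. -/
def IsLocallyGeodesic (hX : IsGeodesicSpace X) (p : ∀ y, Path x₀ y)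
    (N : Subgroup (FundamentalGroup X x₀)) {x y : X} (γ : Path x y) : Prop :=
  ∀ t, ∃ U ∈ 𝓝 t, ∀ a ∈ U, ∀ b ∈ U, a ≤ b →
    hol p N (.mk (γ.subpath a b)) = geoHol hX p N (γ a) (γ b)

variable {N}

theorem isLocallyGeodesic_of_spanierSubgroup_le (hX : IsGeodesicSpace X) {ε : ℝ} (hε : 0 < ε)
    (hN : spanierSubgroup x₀ ε ≤ N) {x y : X} (γ : Path x y) : IsLocallyGeodesic hX p N γ := by
  intro t
  obtain ⟨U, hU, h⟩ := exists_nhds_subpath_dist γ t (half_pos hε)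
  exact ⟨U, hU, fun a ha b hb _ => hol_eq_geoHol_of_small p hX hN fun s => h a ha b hb s⟩

/-- For use when `N` is only known to contain short lassos. Over a parameter interval shorter than
`l / (2 * (a + 1))` the piece and the geodesic between its ends form a loop of length less than `l`.
-/
theorem isLocallyGeodesic_of_isLipPath (hX : IsGeodesicSpace X) {l : ℝ} (hl : 0 < l)
    (hN : lengthSubgroup x₀ l ≤ N) {a : ℝ} (ha : 0 ≤ a) {x y : X} {γ : Path x y}
    (hγ : IsLipPath a γ) : IsLocallyGeodesic hX p N γ := by
  intro t
  have hδ : 0 < l / (4 * (a + 1)) := by positivity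
  refine ⟨Metric.ball t (l / (4 * (a + 1))), Metric.ball_mem_nhds _ hδ, fun s hs u hu _ => ?_⟩
  refine hol_eq_geoHol_of_isLipPath p hX hN (by positivity) (hγ.subpath s u) ?_
  have h1 : dist s u < 2 * (l / (4 * (a + 1))) := by
    linarith [dist_triangle_right s u t, Metric.mem_ball.1 hs, Metric.mem_ball.1 hu]
  have h2 := hγ s u
  have h3 : (a + 1) * dist s u < l / 2 := by
    calc (a + 1) * dist s u < (a + 1) * (2 * (l / (4 * (a + 1)))) := by gcongr
      _ = l / 2 := by field_simp; ring
  nlinarith [dist_nonneg (x := s) (y := u)]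

/-- The classes of paths between vertices of the Rips complex act on the quotient by a normal
subgroup containing the lassos of length less than `3 * r`, compatibly with the holonomy. -/
theorem FineMap.exists_monodromy (Φ : FineMap X r hr) (hX : IsGeodesicSpace X)
    (hN : lengthSubgroup x₀ (3 * r) ≤ N) :
    ∃ M : ∀ x y : X, Quotient (Realization.vertex (rips X r hr) x) (Realization.vertex _ y) →
        FundamentalGroup X x₀ ⧸ N → FundamentalGroup X x₀ ⧸ N,
      (∀ x g, M x x (Quotient.refl _) g = g) ∧
      (∀ x y z q q' g, M x z (q.trans q') g = M y z q' (M x y q g)) ∧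
      ∀ (x y : X) (γ : Path x y), IsLocallyGeodesic hX p N γ →
        ∀ g, M x y (Φ.hat (.mk γ)) g = g * hol p N (.mk γ) := by
  -- The three sides of a triangle in a simplex are each less than `r`, so its perimeter is less
  -- than `3 * r`.
  have hc : IsEdgeCocycle (rips X r hr) (geoHol hX p N) := fun τ hτ u hu v hv w hw => by
    refine geoHol_trans p hX hN ?_
    linarith [dist_lt_of_mem_rips_faces hτ hu hv, dist_lt_of_mem_rips_faces hτ hv hw,
      dist_lt_of_mem_rips_faces hτ hu hw]
  obtain ⟨M, hrefl, htrans, hstar⟩ := RipsPersistence.exists_monodromy _ hc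
  have hseg : ∀ {a b : Realization (rips X r hr)} (h : Contig a b) g,
      M a b (seg h) g = g * geoHol hX p N (someVertex a) (someVertex b) := by
    intro a b h g
    have ⟨τ, hτ, ha, hb⟩ := h
    -- A segment need not lie in one open star. The midpoint carries all vertices of both ends, so
    -- the first half stays in the star of any vertex of `a` and the second in that of any vertex of
    -- `b`.
    let m := lerp h ⟨1 / 2, by norm_num, by norm_num⟩
    have hm : m.weight.support ⊆ τ := lerp_support _ ha hb
    have hmw : ∀ v, m.weight v = 1 / 2 * a.weight v + 1 / 2 * b.weight v := fun v => by
      simp only [m, lerp, Finsupp.add_apply, Finsupp.smul_apply, smul_eq_mul]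
      norm_num
    have hpos : ∀ (w : Realization (rips X r hr)) v, v ∈ w.weight.support → 0 < w.weight v :=
      fun w v hv => lt_of_le_of_ne (w.nonneg v) (Finsupp.mem_support_iff.1 hv).symm
    have ham : ∀ v ∈ a.weight.support, v ∈ m.weight.support := fun v hv => by
      rw [Finsupp.mem_support_iff, hmw]
      have := hpos a v hv
      have := b.nonneg v
      positivity
    have hbm : ∀ v ∈ b.weight.support, v ∈ m.weight.support := fun v hv => by
      rw [Finsupp.mem_support_iff, hmw]
      have := hpos b v hv
      have := a.nonneg v
      positivity
    have hcam : Contig a m := ⟨τ, hτ, ha, hm⟩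
    have hcmb : Contig m b := ⟨τ, hτ, hm, hb⟩
    have hcommon : ∀ {c d : Realization (rips X r hr)} (h : Contig c d) (v : X),
        v ∈ c.weight.support → v ∈ d.weight.support → ∀ t, v ∈ (segPath h t).weight.support := by
      intro c d h v hc hd t
      rw [Finsupp.mem_support_iff]
      change (lerp h t).weight v ≠ 0
      simp only [lerp, Finsupp.add_apply, Finsupp.smul_apply, smul_eq_mul]
      have h1 := hpos c v hc
      have h2 := hpos d v hd
      have h3 := t.2.1
      have h4 := t.2.2
      rcases eq_or_lt_of_le h3 with h5 | h5
      · rw [← h5]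
        simpa using h1.ne'
      · have : 0 ≤ (1 - (t : ℝ)) * c.weight v := mul_nonneg (by linarith) h1.le
        positivity
    have hia := someVertex_mem a
    have hib := someVertex_mem b
    have him := someVertex_mem m
    rw [← seg_trans hτ ha hm hb hcam hcmb h, htrans, seg, seg,
      hstar _ _ _ _ (hcommon hcam _ hia (ham _ hia)), hstar _ _ _ _ (hcommon hcmb _ (hbm _ hib) hib),
      hc.self, hc.self, mul_one, mul_one, mul_assoc,
      hc τ hτ _ (ha hia) _ (hm him) _ (hb hib)]
  refine ⟨fun x y q g => M _ _ q g, fun x g => hrefl _ g, fun x y z q q' g => htrans _ _ _ q q' g,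
    fun x y γ hγ => ?_⟩
  refine path_chain (P := fun x y q => ∀ g, M _ _ (Φ.hat q) g = g * hol p N q) ?_ γ ?_
  · intro x y z q q' hq hq' g
    rw [Φ.hat_trans, htrans, hq, hq', hol_trans, mul_assoc]
  · intro t
    obtain ⟨U, hU, h⟩ := exists_nhds_subpath_dist γ t (by positivity : 0 < r / 5)
    obtain ⟨V, hV, h'⟩ := hγ t
    refine ⟨U ∩ V, Filter.inter_mem hU hV, fun a ha b hb hab g => ?_⟩
    have hd : dist (γ a) (γ b) < r := by
      have := h a ha.1 b hb.1 1
      rw [Path.target, dist_comm] at this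
      linarith
    rw [Φ.hat_mk_of_small (h a ha.1 b hb.1) hd, edge, hseg, someVertex_vertex, someVertex_vertex,
      h' a ha.2 b hb.2 hab]

/-- The homomorphism `π₁(X, x₀) → π₁(Rips(X, r), x₀)` induced by a fine map. -/
def FineMap.hatHom (Φ : FineMap X r hr) (x₀ : X) :
    FundamentalGroup X x₀ →* RipsPi1 x₀ r hr where
  toFun q := Φ.hat q
  map_one' := Φ.hat_refl x₀
  map_mul' q q' := Φ.hat_trans q' q

theorem mem_iff_hol_eq_one {γ : Path x₀ x₀} :
    FundamentalGroup.fromPath (.mk γ) ∈ N ↔ hol p N (.mk γ) = 1 := by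
  rw [← lassoClass_mem_iff p N (Path.refl x₀) γ]
  have : lassoClass (Path.refl x₀) γ = FundamentalGroup.fromPath (.mk γ) := by
    rw [lassoClass_eq, Path.Homotopic.Quotient.mk_refl, Quotient.refl_trans]
    exact Quotient.trans_refl _
  rw [this]

theorem FineMap.hatHom_lassoClass (Φ : FineMap X r hr) {y : X} (α : Path x₀ y) (β : Path y y) :
    Φ.hatHom x₀ (lassoClass α β) = (Φ.hat (.mk α)).trans
      ((Φ.hat (.mk β)).trans (Φ.hat (.mk α)).symm) := by
  rw [lassoClass_eq, ← Φ.hat_symm, ← Φ.hat_trans, ← Φ.hat_trans]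
  rfl

/-- The loop of such a lasso is coned off in the Rips complex, after which the tail cancels against
its inverse. -/
theorem FineMap.spanierSubgroup_le_ker (Φ : FineMap X r hr) (hX : IsGeodesicSpace X) (x₀ : X) :
    spanierSubgroup x₀ (3 * r / 2) ≤ (Φ.hatHom x₀).ker := by
  refine (Subgroup.closure_le _).2 ?_
  rintro _ ⟨y, α, β, w, d, hd, hβ, rfl⟩
  change Φ.hatHom x₀ _ = 1
  rw [Φ.hatHom_lassoClass, Φ.hat_mk_of_closedBall hX hd β hβ, Quotient.refl_trans,
    Quotient.trans_symm]
  rfl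

/-- The fundamental group of `Rips(X, r)` is the quotient by the lassos in balls of radius less
than `3 * r / 2`. -/
theorem FineMap.ker_hatHom (Φ : FineMap X r hr) (hX : IsGeodesicSpace X) (x₀ : X) :
    (Φ.hatHom x₀).ker = spanierSubgroup x₀ (3 * r / 2) := by
  refine le_antisymm (fun q hq => ?_) (Φ.spanierSubgroup_le_ker hX x₀)
  let p : ∀ y, Path x₀ y := fun y => (exists_geodesic_path hX x₀ y).choose
  obtain ⟨γ, rfl⟩ := Path.Homotopic.Quotient.mk_surjective q
  -- Here `N` is the claimed kernel itself. A loop that is trivial in the Rips complex acts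
  -- trivially, and its action is multiplication by its holonomy.
  obtain ⟨M, hrefl, -, hM⟩ := Φ.exists_monodromy p hX
    (lengthSubgroup_le_spanierSubgroup x₀ (3 * r))
  have h1 := hM _ _ γ (isLocallyGeodesic_of_spanierSubgroup_le p hX
    (by positivity : 0 < 3 * r / 2) le_rfl γ) 1
  have h2 : Φ.hat (.mk γ) = Quotient.refl _ := hq
  rw [h2, hrefl, one_mul] at h1
  exact (mem_iff_hol_eq_one p).2 h1.symm

theorem FineMap.hatHom_surjective (Φ : FineMap X r hr) (hX : IsGeodesicSpace X) (x₀ : X) :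
    Function.Surjective (Φ.hatHom x₀) := fun q =>
  Φ.hat_surjective (fun x y => ⟨_, fun t =>
    (exists_geodesic_path hX x y).choose_spec.dist_left_le dist_nonneg t⟩) q

/-- The bonding homomorphism is an isomorphism exactly if the kernels agree. -/
theorem bonding_bijective_iff [CompactSpace X] (hX : IsGeodesicSpace X) (x₀ : X) (hr : 0 < r)
    {s : ℝ} (h : r ≤ s) : Function.Bijective (bonding x₀ hr h) ↔
      spanierSubgroup x₀ (3 * r / 2) = spanierSubgroup x₀ (3 * s / 2) := by
  obtain ⟨Φ⟩ := exists_fineMap X r hr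
  -- A fine map at scale `r`, followed by the inclusion, serves at scale `s`. The bonding map is
  -- thus the map between two quotients of `π₁(X, x₀)`.
  have hcomp : ∀ q, bonding x₀ hr h (Φ.hatHom x₀ q) = (Φ.incl h).hatHom x₀ q := fun q =>
    (Φ.hat_incl h q).symm
  have hk := Φ.ker_hatHom hX x₀
  have hk' := (Φ.incl h).ker_hatHom hX x₀
  constructor
  · intro hb
    rw [← hk, ← hk']
    ext q
    rw [MonoidHom.mem_ker, MonoidHom.mem_ker, ← hcomp, map_eq_one_iff _ hb.1]
  · intro heq
    rw [← hk, ← hk'] at heq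
    constructor
    · rw [injective_iff_map_eq_one]
      intro q hq
      obtain ⟨q, rfl⟩ := Φ.hatHom_surjective hX x₀ q
      rw [hcomp, ← MonoidHom.mem_ker, ← heq] at hq
      exact hq
    · intro q
      obtain ⟨q, rfl⟩ := (Φ.incl h).hatHom_surjective hX x₀ q
      exact ⟨_, hcomp q⟩

end Kernel

/-! ### Compactness of the space of Lipschitz loops -/

section Compactness

variable {X : Type*} [MetricSpace X]

/-- The `l`-Lipschitz loops, as continuous maps. -/
def lipLoops (X : Type*) [MetricSpace X] (l : ℝ) : Set C(unitInterval, X) :=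
  {f | f 0 = f 1 ∧ ∀ s t, dist (f s) (f t) ≤ l * dist s t}

/-- Arzelà–Ascoli: a common Lipschitz constant gives equicontinuity, and the defining conditions are
closed under pointwise convergence. -/
theorem isCompact_lipLoops [CompactSpace X] (l : ℝ) : IsCompact (lipLoops X l) := by
  have hlip : ∀ f : unitInterval → X, (∀ s t, dist (f s) (f t) ≤ l * dist s t) →
      LipschitzWith l.toNNReal f := fun f hf => LipschitzWith.of_dist_le_mul fun s t =>
    (hf s t).trans (mul_le_mul_of_nonneg_right (Real.le_coe_toNNReal l) dist_nonneg)
  refine ArzelaAscoli.isCompact_of_equicontinuous _ ?_ ?_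
  · have himage : ContinuousMap.toFun '' lipLoops X l =
        {f | f 0 = f 1 ∧ ∀ s t, dist (f s) (f t) ≤ l * dist s t} := by
      ext f
      constructor
      · rintro ⟨g, hg, rfl⟩
        exact hg
      · intro hf
        exact ⟨⟨f, (hlip f hf.2).continuous⟩, hf, rfl⟩
    rw [himage]
    refine IsClosed.isCompact (IsClosed.and (isClosed_eq (continuous_apply _) (continuous_apply _)) ?_)
    simp only [Set.ofPred_forall]
    exact isClosed_iInter fun s => isClosed_iInter fun t =>
      isClosed_le ((continuous_apply s).dist (continuous_apply t)) continuous_const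
  · exact (LipschitzWith.uniformEquicontinuous _ l.toNNReal fun f : lipLoops X l =>
      hlip f.1 f.2.2).equicontinuous

/-- The loop given by a closed map. -/
def loopOf (f : C(unitInterval, X)) (h : f 0 = f 1) : Path (f 0) (f 0) :=
  ⟨f, rfl, h.symm⟩

theorem IsLipPath.mem_lipLoops {l : ℝ} {y : X} {β : Path y y} (h : IsLipPath l β) :
    β.toContinuousMap ∈ lipLoops X l :=
  ⟨β.source.trans β.target.symm, h⟩

variable {x₀ : X} [CompactSpace X]

/-- Up to lassos in balls of radius less than `ε`, there are finitely many lassos of bounded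
length. -/
theorem exists_finite_lassos (hX : IsGeodesicSpace X) (x₀ : X) {ε : ℝ} (hε : 0 < ε) (b : ℝ) :
    ∃ F : Set (FundamentalGroup X x₀), F.Finite ∧
      ∀ l ≤ b, ∀ N N' : Subgroup (FundamentalGroup X x₀), N.Normal → N'.Normal →
        spanierSubgroup x₀ ε ≤ N → spanierSubgroup x₀ ε ≤ N' → lengthSubgroup x₀ l ≤ N' →
        (∀ g ∈ F, g ∈ N' → g ∈ N) → lengthSubgroup x₀ l ≤ N := by
  let p : ∀ y, Path x₀ y := fun y => (exists_geodesic_path hX x₀ y).choose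
  -- The centres of a finite `ε / 4`-net of Lipschitz loops are the test elements: every short loop
  -- has trivial holonomy together with a nearby centre, both modulo `N` and modulo `N'`.
  obtain ⟨t, ht, htf, hcov⟩ := (isCompact_lipLoops (X := X) b).finite_cover_balls
    (by positivity : 0 < ε / 4)
  have htf' := htf.to_subtype
  let c : t → FundamentalGroup X x₀ := fun f => lassoClass (p _) (loopOf f.1 (ht f.2).1)
  refine ⟨Set.range c, Set.finite_range c, fun l hlb N N' hN hN' hεN hεN' hl hF => ?_⟩
  refine (lengthSubgroup_le_iff p N).2 fun y β hβ => ?_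
  have h1 := (lengthSubgroup_le_iff p N').1 hl y β hβ
  obtain ⟨γ, hγ, l', hl', -, hlip⟩ := exists_isLipPath_of_pathLength_lt hβ
  rw [hγ] at h1 ⊢
  have hmem := hcov (hlip.mono (hl'.le.trans hlb)).mem_lipLoops
  simp only [Set.mem_iUnion] at hmem
  obtain ⟨f, hf, hd⟩ := hmem
  have hd' : ∀ s, dist (γ s) (loopOf f (ht hf).1 s) < ε / 4 := fun s =>
    (ContinuousMap.dist_apply_le_dist s).trans_lt hd
  have h2 := hol_eq_one_of_close p hX hεN' hd' h1
  have h3 := hF _ ⟨⟨f, hf⟩, rfl⟩ ((lassoClass_mem_iff p N' _ _).2 h2)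
  exact hol_eq_one_of_close p hX hεN (fun s => by rw [dist_comm]; exact hd' s)
    ((lassoClass_mem_iff p N _ _).1 h3)

/-- The subgroups `spanierSubgroup x₀ s`, with `s` in a compact interval of positive reals, are
distinguished by finitely many elements. -/
theorem exists_finite_separating (hX : IsGeodesicSpace X) (x₀ : X) {ε : ℝ} (hε : 0 < ε) (b : ℝ) :
    ∃ F : Set (FundamentalGroup X x₀), F.Finite ∧
      ∀ s s' : ℝ, ε ≤ s → s ≤ s' → s' ≤ b →
        (∀ g ∈ F, g ∈ spanierSubgroup x₀ s' → g ∈ spanierSubgroup x₀ s) →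
        spanierSubgroup x₀ s = spanierSubgroup x₀ s' := by
  obtain ⟨F, hFfin, hF⟩ := exists_finite_lassos hX x₀ hε (2 * b)
  refine ⟨F, hFfin, fun s s' hs hss' hs' h => le_antisymm (spanierSubgroup_mono x₀ hss') ?_⟩
  -- Only the loops of length less than `2 * s'` need to be tested, since modulo `spanierSubgroup x₀
  -- ε` they generate the group at scale `s'`.
  have h1 := hF (2 * s') (by linarith) _ _ inferInstance inferInstance (spanierSubgroup_mono x₀ hs)
    (spanierSubgroup_mono x₀ (hs.trans hss')) (by
      simpa using lengthSubgroup_le_spanierSubgroup x₀ (2 * s')) h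
  simpa using spanierSubgroup_le_of_lengthSubgroup_le hX hε h1 (spanierSubgroup_mono x₀ hs)

/-- The filtration by the subgroups `spanierSubgroup x₀ s` has no jumps from the left. -/
theorem exists_lt_spanierSubgroup_eq (hX : IsGeodesicSpace X) (x₀ : X) {r : ℝ} (hr : 0 < r) :
    ∃ s < r, spanierSubgroup x₀ s = spanierSubgroup x₀ r := by
  obtain ⟨F, hFfin, hF⟩ := exists_finite_separating hX x₀ (half_pos hr) r
  -- Each test element in the group at scale `r` already occurs at a smaller scale; finitely many
  -- such scales have a maximum below `r`.
  have hex : ∃ s < r, ∀ g ∈ F, g ∈ spanierSubgroup x₀ r → g ∈ spanierSubgroup x₀ s := by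
    refine hFfin.induction_on_subset (motive := fun F _ => ∃ s < r, ∀ g ∈ F,
      g ∈ spanierSubgroup x₀ r → g ∈ spanierSubgroup x₀ s) _ ⟨r - 1, by linarith, by simp⟩ ?_
    rintro g F' - - - ⟨s, hs, h⟩
    by_cases hg : g ∈ spanierSubgroup x₀ r
    · obtain ⟨s', hs', hg'⟩ := exists_mem_spanierSubgroup_of_mem hg
      refine ⟨max s s', max_lt hs hs', fun k hk hkr => ?_⟩
      rcases Set.mem_insert_iff.1 hk with rfl | hk
      · exact spanierSubgroup_mono x₀ (le_max_right _ _) hg'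
      · exact spanierSubgroup_mono x₀ (le_max_left _ _) (h k hk hkr)
    · refine ⟨s, hs, fun k hk hkr => ?_⟩
      rcases Set.mem_insert_iff.1 hk with rfl | hk
      · exact absurd hkr hg
      · exact h k hk hkr
  obtain ⟨s, hs, h⟩ := hex
  -- The test set is valid only for scales in `[r / 2, r]`.
  refine ⟨max s (r / 2), max_lt hs (by linarith), hF _ _ (le_max_right _ _)
    (max_le hs.le (by linarith)) le_rfl fun g hg hgr =>
    spanierSubgroup_mono x₀ (le_max_left _ _) (h g hg hgr)⟩

variable {N : Subgroup (FundamentalGroup X x₀)} [N.Normal]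

/-- If all lassos longer than `l` are needed, then some geodesic circle of length `l` is. -/
theorem exists_isGeodesicCircleLoop (p : ∀ y, Path x₀ y) (hX : IsGeodesicSpace X) {l ε : ℝ}
    (hl : 0 < l) (hε : 0 < ε) (hεN : spanierSubgroup x₀ ε ≤ N) (hlN : lengthSubgroup x₀ l ≤ N)
    (h : ∀ l' > l, ¬ lengthSubgroup x₀ l' ≤ N) :
    ∃ (y : X) (β : Path y y), IsGeodesicCircleLoop l β ∧ hol p N (.mk β) ≠ 1 := by
  -- Loops with nontrivial holonomy and length below `l + 1 / (n + 1)`, made Lipschitz, have a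
  -- uniform limit point. It is `l`-Lipschitz, and modulo lassos in `ε`-balls it cannot be trivial
  -- while late terms are not.
  have hseq : ∀ n : ℕ, ∃ (y : X) (β : Path y y), IsLipPath (l + 1 / ((n : ℝ) + 1)) β ∧
      hol p N (.mk β) ≠ 1 := by
    intro n
    have := h (l + 1 / ((n : ℝ) + 1)) (lt_add_of_pos_right l (by positivity))
    rw [lengthSubgroup_le_iff p N] at this
    push Not at this
    obtain ⟨y, β, hβ, hne⟩ := this
    obtain ⟨γ, hγ, l', hl', -, hlip⟩ := exists_isLipPath_of_pathLength_lt hβ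
    exact ⟨y, γ, hlip.mono hl'.le, hγ ▸ hne⟩
  choose y β hβ hne using hseq
  have hbd : ∀ n : ℕ, l + 1 / ((n : ℝ) + 1) ≤ l + 1 := fun n => by
    have : 1 / ((n : ℝ) + 1) ≤ 1 := by
      rw [div_le_one (by positivity)]
      linarith [n.cast_nonneg (α := ℝ)]
    linarith
  obtain ⟨f, hf, φ, hφ, hlim⟩ := (isCompact_lipLoops (X := X) (l + 1)).tendsto_subseq
    fun n => ((hβ n).mono (hbd n)).mem_lipLoops
  have hev : ∀ t, Filter.Tendsto (fun n => β (φ n) t) Filter.atTop (𝓝 (f t)) := fun t =>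
    ((continuous_eval_const t).tendsto f).comp hlim
  have hflip : IsLipPath l (loopOf f hf.1) := fun s t => by
    have h1 : Filter.Tendsto (fun n : ℕ => (l + 1 / ((n : ℝ) + 1)) * dist s t) Filter.atTop
        (𝓝 ((l + 0) * dist s t)) :=
      (tendsto_const_nhds.add tendsto_one_div_add_atTop_nhds_zero_nat).mul_const _
    rw [add_zero] at h1
    exact le_of_tendsto_of_tendsto' ((hev s).dist (hev t)) (h1.comp hφ.tendsto_atTop)
      fun n => hβ (φ n) s t
  have hfne : hol p N (.mk (loopOf f hf.1)) ≠ 1 := fun h1 => by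
    obtain ⟨n, hn⟩ := (Metric.tendsto_atTop.1 hlim (ε / 4) (by positivity))
    refine hne (φ n) (hol_eq_one_of_close p hX hεN (fun t => ?_) h1)
    rw [dist_comm]
    exact (ContinuousMap.dist_apply_le_dist t).trans_lt (hn n le_rfl)
  exact ⟨_, _, (hol_eq_one_or_isGeodesicCircleLoop p hX hl hlN hflip).resolve_left hfne, hfne⟩

end Compactness

/-! ### Critical values -/

section Critical

variable {X : Type*} [MetricSpace X]

theorem IsCriticalValue.pos {x₀ : X} {q : ℝ} (h : IsCriticalValue x₀ q) : 0 < q :=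
  h.elim (fun h => h.1) fun h => h.1

variable {x₀ : X} {q p : ℝ}

theorem IsGeodesicCircleLoop.isLipPath {l : ℝ} {y : X} {β : Path y y}
    (h : IsGeodesicCircleLoop l β) : IsLipPath l β := by
  obtain ⟨f, ⟨hl, hf⟩, hβ⟩ := h
  intro s t
  rw [hβ, hβ, hf.dist_eq, dist_eq_norm, ← AddCircle.coe_sub]
  refine (QuotientAddGroup.norm_mk_le_norm (S := AddSubgroup.zmultiples l)
    (m := l * (s : ℝ) - l * (t : ℝ))).trans (le_of_eq ?_)
  rw [← mul_sub, Real.norm_eq_abs, abs_mul, abs_of_pos hl, Subtype.dist_eq, Real.dist_eq]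

theorem closure_geodesicLassoClasses_le {l l' : ℝ} (hl : 0 < l) (h : l < l') :
    Subgroup.closure (geodesicLassoClasses x₀ l) ≤ lengthSubgroup x₀ l' := by
  rw [Subgroup.closure_le]
  rintro _ ⟨y, α, β, hβ, rfl⟩
  exact Subgroup.subset_closure ⟨y, α, β, (pathLength_le_of_isLipPath hβ.isLipPath).trans_lt
    ((ENNReal.ofReal_lt_ofReal_iff (hl.trans h)).2 h), rfl⟩

/-- By `spanierSubgroup_eq_sup`, the group at scale `3 * p / 2` is generated by the lassos shorter
than `3 * p` and the group at scale `3 * q / 2`. Substituting `hA` leaves lassos shorter than `3 *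
q`, which the latter absorbs. -/
theorem AreConsecutiveCritical.spanierSubgroup_eq (hX : IsGeodesicSpace X)
    (h : AreConsecutiveCritical x₀ q p) {A : Set (FundamentalGroup X x₀)}
    (hA : lengthSubgroup x₀ (3 * p) = lengthSubgroup x₀ (3 * q) ⊔ Subgroup.closure A) :
    spanierSubgroup x₀ (3 * p / 2) = spanierSubgroup x₀ (3 * q / 2) ⊔ Subgroup.closure A := by
  have hq := h.2.1.pos
  have hqp := h.1
  rw [spanierSubgroup_eq_sup hX x₀ (by positivity : 0 < 3 * q / 2) (by linarith), hA, sup_right_comm,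
    sup_eq_right.2 (lengthSubgroup_le_spanierSubgroup x₀ (3 * q))]

variable [CompactSpace X]

/-- The kernels `spanierSubgroup x₀ s` are stationary as `s` approaches a positive value from below.
-/
theorem not_isLeftCritical (hX : IsGeodesicSpace X) (x₀ : X) (q : ℝ) : ¬ IsLeftCritical x₀ q := by
  rintro ⟨hq, δ, hδ, h⟩
  obtain ⟨s, hs, heq⟩ := exists_lt_spanierSubgroup_eq hX x₀ (by positivity : 0 < 3 * q / 2)
  -- The three bounds ensure `ε < δ`, `0 < q - ε`, and `s ≤ 3 * (q - ε) / 2`.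
  have hε : 0 < min (δ / 2) (min (q / 2) (q - 2 * s / 3)) :=
    lt_min (half_pos hδ) (lt_min (half_pos hq) (by linarith))
  set ε := min (δ / 2) (min (q / 2) (q - 2 * s / 3))
  have h1 : ε ≤ δ / 2 := min_le_left _ _
  have h2 : ε ≤ q / 2 := (min_le_right _ _).trans (min_le_left _ _)
  have h3 : ε ≤ q - 2 * s / 3 := (min_le_right _ _).trans (min_le_right _ _)
  refine h ε hε (by linarith) (by linarith) (by linarith) ((bonding_bijective_iff hX x₀ _ _).2 ?_)
  refine le_antisymm (spanierSubgroup_mono x₀ (by linarith)) ?_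
  rw [← heq]
  exact spanierSubgroup_mono x₀ (by linarith)

/-- With left jumps excluded, a value is critical exactly if the kernel grows at once to its right.
-/
theorem isCriticalValue_iff (hX : IsGeodesicSpace X) (x₀ : X) {q : ℝ} (hq : 0 < q) :
    IsCriticalValue x₀ q ↔
      ∀ s > q, spanierSubgroup x₀ (3 * q / 2) ≠ spanierSubgroup x₀ (3 * s / 2) := by
  rw [IsCriticalValue, or_iff_right (not_isLeftCritical hX x₀ q)]
  constructor
  · rintro ⟨hq, h⟩ s hs heq
    refine h (s - q) (by linarith) (by linarith) ((bonding_bijective_iff hX x₀ _ _).2 ?_)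
    rw [heq, add_sub_cancel]
  · exact fun h => ⟨hq, fun ε hε hle hb =>
      h (q + ε) (by linarith) ((bonding_bijective_iff hX x₀ _ _).1 hb)⟩

/-- If the kernel contained all lassos shorter than some `l' > 3 * q`, it would contain the group at
scale `l' / 2`, and there would be no jump. So lassos just longer than `3 * q` are needed, and their
limit is the circle. -/
theorem IsCriticalValue.exists_isGeodesicCircle (hX : IsGeodesicSpace X) {x₀ : X} {q : ℝ}
    (h : IsCriticalValue x₀ q) : ∃ f : AddCircle (3 * q) → X, IsGeodesicCircle (3 * q) f := by
  have hq := h.pos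
  have h3 : 0 < 3 * q / 2 := by positivity
  obtain ⟨y, β, ⟨f, hf, -⟩, -⟩ := exists_isGeodesicCircleLoop (l := 3 * q) (ε := 3 * q / 2)
    (N := spanierSubgroup x₀ (3 * q / 2)) (fun y => (exists_geodesic_path hX x₀ y).choose) hX
    (by positivity) h3 le_rfl (lengthSubgroup_le_spanierSubgroup x₀ (3 * q)) fun l' hl' hle => by
      refine (isCriticalValue_iff hX x₀ hq).1 h (l' / 3) (by linarith) ?_
      refine le_antisymm (spanierSubgroup_mono x₀ (by linarith)) ?_
      rw [show 3 * (l' / 3) / 2 = l' / 2 by ring]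
      exact spanierSubgroup_le_of_lengthSubgroup_le hX h3 hle le_rfl
  exact ⟨f, hf⟩

/-- Critical values are bounded by the diameter. -/
theorem IsCriticalValue.le_diam (hX : IsGeodesicSpace X) {x₀ : X} {q : ℝ}
    (h : IsCriticalValue x₀ q) : 3 * q / 2 ≤ Metric.diam (Set.univ : Set X) := by
  have hq := h.pos
  obtain ⟨f, hf⟩ := h.exists_isGeodesicCircle hX
  have h1 : dist (f ((3 * q / 2 : ℝ) : AddCircle (3 * q))) (f 0) = 3 * q / 2 := by
    rw [hf.2.dist_eq, dist_zero_right, AddCircle.norm_half_period_eq, abs_of_pos hf.1]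
  rw [← h1]
  exact Metric.dist_le_diam_of_mem isCompact_univ.isBounded trivial trivial

/-- The kernel jumps after each critical value, and below the diameter bound the jumps are seen by
one finite test set `F`. Hence distinct critical values give distinct subsets of `F`. -/
theorem finite_isCriticalValue (hX : IsGeodesicSpace X) (x₀ : X) {r : ℝ} (hr : 0 < r) :
    {c : ℝ | r < c ∧ IsCriticalValue x₀ c}.Finite := by
  obtain ⟨F, hFfin, hF⟩ := exists_finite_separating hX x₀ (by positivity : 0 < 3 * r / 2)
    (Metric.diam (Set.univ : Set X))
  refine Set.Finite.of_finite_image (f := fun c => F ∩ spanierSubgroup x₀ (3 * c / 2))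
    (hFfin.finite_subsets.subset ?_) ?_
  · rintro _ ⟨c, -, rfl⟩
    exact Set.inter_subset_left
  · have key : ∀ c c', r < c → IsCriticalValue x₀ c → IsCriticalValue x₀ c' → c < c' →
        F ∩ spanierSubgroup x₀ (3 * c / 2) ≠ F ∩ spanierSubgroup x₀ (3 * c' / 2) := by
      intro c c' hrc hc hc' hlt heq
      refine (isCriticalValue_iff hX x₀ hc.pos).1 hc c' hlt (hF _ _ (by linarith) (by linarith)
        (hc'.le_diam hX) fun g hg hg' => ?_)
      exact (heq.symm.subset ⟨hg, hg'⟩).2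
    rintro c ⟨hc, hcc⟩ c' ⟨hc', hcc'⟩ heq
    rcases lt_trichotomy c c' with hlt | heq' | hlt
    · exact absurd heq (key c c' hc hcc hcc' hlt)
    · exact heq'
    · exact absurd heq.symm (key c' c hc' hcc' hcc hlt)

/-- Up to the next critical value, only geodesic circles are needed. -/
theorem AreConsecutiveCritical.spanierSubgroup_le (hX : IsGeodesicSpace X)
    (h : AreConsecutiveCritical x₀ q p) : spanierSubgroup x₀ (3 * p / 2) ≤
      spanierSubgroup x₀ (3 * q / 2) ⊔ Subgroup.closure (geodesicLassoClasses x₀ (3 * q)) := by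
  obtain ⟨hqp, hq, -, hno⟩ := h
  have hq0 := hq.pos
  set N := spanierSubgroup x₀ (3 * q / 2) ⊔ Subgroup.closure (geodesicLassoClasses x₀ (3 * q))
  -- Continuous induction on the scale. Its supremum belongs to `P` because every element of a
  -- Spanier-type group already occurs at a smaller scale.
  let P : Set ℝ := {s | s ≤ p ∧ spanierSubgroup x₀ (3 * s / 2) ≤ N}
  have hqP : q ∈ P := ⟨hqp.le, le_sup_left⟩
  have hbdd : BddAbove P := ⟨p, fun s hs => hs.1⟩
  let t := sSup P
  have htp : t ≤ p := csSup_le ⟨q, hqP⟩ fun s hs => hs.1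
  have hqt : q ≤ t := le_csSup hbdd hqP
  have htN : spanierSubgroup x₀ (3 * t / 2) ≤ N := fun g hg => by
    obtain ⟨s, hs, hgs⟩ := exists_mem_spanierSubgroup_of_mem hg
    obtain ⟨s', hs', hlt⟩ := exists_lt_of_lt_csSup ⟨q, hqP⟩ (by linarith : 2 * s / 3 < sSup P)
    exact hs'.2 (spanierSubgroup_mono x₀ (by linarith) hgs)
  rcases htp.eq_or_lt with heq | hlt
  · rwa [heq] at htN
  have hext : ∀ s > t, ¬ spanierSubgroup x₀ (3 * s / 2) ≤ N := fun s hs hsN => by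
    have : min s p ∈ P := ⟨min_le_right _ _, (spanierSubgroup_mono x₀ (by
      linarith [min_le_left s p])).trans hsN⟩
    exact absurd (le_csSup hbdd this) (not_le.2 (lt_min hs hlt))
  rcases hqt.eq_or_lt with heq | hqt
  -- Stopping at `q` itself would produce a geodesic circle of length `3 * q` that is nontrivial
  -- modulo `N`, but `N` contains all such lassos.
  · exfalso
    let p : ∀ y, Path x₀ y := fun y => (exists_geodesic_path hX x₀ y).choose
    obtain ⟨y, β, hβ, hne⟩ := exists_isGeodesicCircleLoop (l := 3 * q) (ε := 3 * q / 2) (N := N)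
      p hX (by positivity) (by positivity) le_sup_left
      ((lengthSubgroup_le_spanierSubgroup x₀ (3 * q)).trans le_sup_left) fun l' hl' hle => by
        refine hext (l' / 3) (by rw [← heq]; linarith) ?_
        rw [show 3 * (l' / 3) / 2 = l' / 2 by ring]
        exact spanierSubgroup_le_of_lengthSubgroup_le hX (by positivity : 0 < 3 * q / 2) hle
          le_sup_left
    exact hne ((lassoClass_mem_iff p N (p y) β).1
      (le_sup_right (a := spanierSubgroup x₀ (3 * q / 2))
        (Subgroup.subset_closure ⟨y, p y, β, hβ, rfl⟩)))
  -- Strictly between `q` and `p` there is no jump, so the scale can be increased beyond `t`.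
  · have h1 := hno t hqt hlt
    rw [isCriticalValue_iff hX x₀ (hq0.trans hqt)] at h1
    push Not at h1
    obtain ⟨s, hs, heq⟩ := h1
    exact absurd (heq ▸ htN) (hext s hs)

/-- Loops in small balls do not help to decompose a short loop into shorter ones. -/
theorem lengthSubgroup_le_of_le_spanierSubgroup_sup (hX : IsGeodesicSpace X) (hq : 0 < q) {l : ℝ}
    (h : lengthSubgroup x₀ l ≤
      spanierSubgroup x₀ (3 * q / 2) ⊔ Subgroup.closure (geodesicLassoClasses x₀ (3 * q))) :
    lengthSubgroup x₀ l ≤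
      lengthSubgroup x₀ (3 * q) ⊔ Subgroup.closure (geodesicLassoClasses x₀ (3 * q)) := by
  set N := lengthSubgroup x₀ (3 * q) ⊔ Subgroup.closure (geodesicLassoClasses x₀ (3 * q))
  have h3 : 0 < 3 * q := by positivity
  have hN : lengthSubgroup x₀ (3 * q) ≤ N := le_sup_left
  let p : ∀ y, Path x₀ y := fun y => (exists_geodesic_path hX x₀ y).choose
  obtain ⟨Φ⟩ := exists_fineMap X q hq
  obtain ⟨M, hrefl, htrans, hM⟩ := Φ.exists_monodromy p hX hN
  have hlasso : ∀ (y : X) (α : Path x₀ y) (β : Path y y) k, M _ _ (Φ.hatHom x₀ (lassoClass α β)) k =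
      M _ _ (Φ.hat (.mk α)).symm (M _ _ (Φ.hat (.mk β)) (M _ _ (Φ.hat (.mk α)) k)) := by
    intro y α β k
    rw [Φ.hatHom_lassoClass, htrans, htrans]
  have hsymm : ∀ (y : X) (α : Path x₀ y) k,
      M _ _ (Φ.hat (.mk α)).symm (M _ _ (Φ.hat (.mk α)) k) = k := by
    intro y α k
    rw [← htrans, Quotient.trans_symm, hrefl]
  have hsymm' : ∀ (y : X) (α : Path x₀ y) k,
      M _ _ (Φ.hat (.mk α)) (M _ _ (Φ.hat (.mk α)).symm k) = k := by
    intro y α k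
    rw [← htrans, Quotient.symm_trans, hrefl]
  -- The classes whose image in the Rips complex acts trivially. Membership is compared with `N`
  -- only for lassos with Lipschitz loops, where monodromy is holonomy; the tails may be arbitrary
  -- since their action cancels.
  let H : Subgroup (FundamentalGroup X x₀) :=
    { carrier := {g | ∀ k, M x₀ x₀ (Φ.hatHom x₀ g) k = k}
      one_mem' := fun k => by
        rw [map_one]
        exact hrefl _ k
      mul_mem' := fun {a b} ha hb k => by
        rw [map_mul, FundamentalGroup.mul_def, htrans, hb, ha]
      inv_mem' := fun {a} ha k => by
        have h1 : M x₀ x₀ (Φ.hatHom x₀ (a⁻¹ * a)) k = k := by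
          rw [inv_mul_cancel, map_one]
          exact hrefl _ k
        rw [map_mul, FundamentalGroup.mul_def, htrans, ha] at h1
        exact h1 }
  have hH : spanierSubgroup x₀ (3 * q / 2) ⊔ Subgroup.closure (geodesicLassoClasses x₀ (3 * q)) ≤
      H := by
    refine sup_le (fun g hg k => ?_) ((Subgroup.closure_le _).2 ?_)
    · rw [Φ.spanierSubgroup_le_ker hX x₀ hg]
      exact hrefl _ k
    · rintro _ ⟨y, α, β, hβ, rfl⟩ k
      have h1 : hol p N (.mk β) = 1 := (lassoClass_mem_iff p N α β).1
        (le_sup_right (a := lengthSubgroup x₀ (3 * q))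
          (Subgroup.subset_closure ⟨y, α, β, hβ, rfl⟩))
      rw [hlasso, hM y y β (isLocallyGeodesic_of_isLipPath p hX h3 hN h3.le hβ.isLipPath), h1,
        mul_one, hsymm]
  refine (lengthSubgroup_le_iff p N).2 fun y β hβ => ?_
  have hmem : lassoClass (p y) β ∈ H := hH (h (Subgroup.subset_closure ⟨y, p y, β, hβ, rfl⟩))
  obtain ⟨γ, hγ, l', -, hl', hlip⟩ := exists_isLipPath_of_pathLength_lt hβ
  -- The argument is chosen so that the tail carries it to `1`; the loop then acts on `1` by its
  -- holonomy.
  have h1 := hmem (M _ _ (Φ.hat (.mk (p y))).symm 1)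
  rw [hlasso, hsymm', hγ, hM y y γ (isLocallyGeodesic_of_isLipPath p hX h3 hN hl' hlip),
    one_mul] at h1
  have h2 := congrArg (M _ _ (Φ.hat (.mk (p y)))) h1
  rw [hsymm', hsymm'] at h2
  rw [hγ, h2]

/-- A lasso shorter than `3 * p` lies in a ball of radius below `3 * p / 2`, hence is generated by
small balls and circles. The balls are then traded for lassos shorter than `3 * q`. -/
theorem AreConsecutiveCritical.lengthSubgroup_eq (hX : IsGeodesicSpace X)
    (h : AreConsecutiveCritical x₀ q p) : lengthSubgroup x₀ (3 * p) =
      lengthSubgroup x₀ (3 * q) ⊔ Subgroup.closure (geodesicLassoClasses x₀ (3 * q)) := by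
  have hq := h.2.1.pos
  have hqp := h.1
  refine le_antisymm (lengthSubgroup_le_of_le_spanierSubgroup_sup hX hq
    ((lengthSubgroup_le_spanierSubgroup x₀ (3 * p)).trans (h.spanierSubgroup_le hX)))
    (sup_le (lengthSubgroup_mono x₀ (by linarith))
      (closure_geodesicLassoClasses_le (by linarith) (by linarith)))

end Critical

end RipsPersistence

end

/-! ### The main theorem -/

theorem mainTheorem3 {X : Type*} [MetricSpace X] [CompactSpace X]
    (hX : RipsPersistence.IsGeodesicSpace X) (x₀ : X) :
    -- finitely many critical values above each positive threshold
    (∀ r : ℝ, 0 < r → {c : ℝ | r < c ∧ RipsPersistence.IsCriticalValue x₀ c}.Finite) ∧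
    -- generation of the length subgroups between consecutive critical values
    (∀ q p : ℝ, RipsPersistence.AreConsecutiveCritical x₀ q p →
      ∃ A : Set (FundamentalGroup X x₀), A ⊆ RipsPersistence.geodesicLassoClasses x₀ (3 * q) ∧
        RipsPersistence.lengthSubgroup x₀ (3 * p) =
          RipsPersistence.lengthSubgroup x₀ (3 * q) ⊔ Subgroup.closure A) ∧
    -- every critical value comes from a geodesic circle
    (∀ q : ℝ, RipsPersistence.IsCriticalValue x₀ q →
      ∃ f : AddCircle (3 * q) → X, RipsPersistence.IsGeodesicCircle (3 * q) f) ∧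
    -- the same (that is, any such) collection of lassos generates the Spanier-type subgroups
    (∀ q p : ℝ, RipsPersistence.AreConsecutiveCritical x₀ q p →
      ∀ A : Set (FundamentalGroup X x₀), A ⊆ RipsPersistence.geodesicLassoClasses x₀ (3 * q) →
        RipsPersistence.lengthSubgroup x₀ (3 * p) =
          RipsPersistence.lengthSubgroup x₀ (3 * q) ⊔ Subgroup.closure A →
        RipsPersistence.spanierSubgroup x₀ (3 * p / 2) =
          RipsPersistence.spanierSubgroup x₀ (3 * q / 2) ⊔ Subgroup.closure A) := by
  exact ⟨fun r hr => RipsPersistence.finite_isCriticalValue hX x₀ hr,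
    -- The collection of all geodesic `3 * q`-lassos serves as `A`.
    fun q p h => ⟨_, subset_rfl, h.lengthSubgroup_eq hX⟩,
    fun q h => h.exists_isGeodesicCircle hX,
    fun q p h A _ hA => h.spanierSubgroup_eq hX hA⟩
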